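/- **Theorem.** Let $M$ be a weak DAP TM implementation in the class $\mathcal{RWF}$ for $n\ge 3$ processes, with a set $\mathcal X$ of t-objects and a domain $V$ of at least two values. Let $m\in\mathbb N$ and let $X_1,\dots,X_m\in\mathcal X$ be distinct. Then any transaction $T_0$ (with any identifier, on any process) that runs alone from the initial configuration, performs the t-reads of $X_1,\dots,X_m$ in this order and then invokes $\mathit{tryC}$ completes all of these operations and commits. In this execution $T_0$ is read-only, $|\mathrm{Rset}(T_0)|=m$, and each of its first $m-1$ t-reads contains a RAW or an AWAR; hence $T_0$ performs at least $m-1$, i.e. $\Omega(m)$, RAWs/AWARs (counted as the number of disjoint consecutive fragments of the execution each of which contains one). **Definitions.** *Model.* Processes run deterministic algorithms for the t-operations read, write and $\mathit{tryC}$ of dynamic transactions by applying primitives $\langle g,h\rangle$ to base objects: applied in state $s$, the primitive changes the state to $g(s)$ and responds $h(s)$. It is trivial if $g=\mathrm{id}$, and nontrivial otherwise. Each process runs its transactions one after the other; a process may keep local state between them. An execution is a sequence of events (invocations and responses of t-operations, applications of primitives) issued according to $M$ from the initial configuration. $\mathrm{Rset}(T)$ and $\mathrm{Wset}(T)$ are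 the sets of t-objects on which $T$ invokes reads and writes, and $\mathrm{Dset}(T)$ is their union; $T$ is read-only if $\mathrm{Wset}(T)=\emptyset$. $T$ is t-complete once it has committed or aborted. $T$ precedes $T'$ if $T$ is t-complete and its last event comes before the first event of $T'$; $T$ and $T'$ are concurrent if neither precedes the other. *$\mathcal{RWF}$.* (i) Every finite execution is strictly serializable: for some completion of its history (pending reads and writes abort, each pending $\mathit{tryC}$ commits or aborts, and other live transactions abort), the committed transactions can be ordered one after the other, respecting the order of precedence, so that every read returns the latest written value (initially, the initial value). (ii) In every execution, every read-only transaction commits in a finite number of its steps: it is never aborted, and each of its t-operations returns after finitely many of its own steps. (iii) The same holds for every transaction that runs step contention-free (with no events of other transactions) from a configuration in which all earlier transactions are t-complete. *Weak DAP.* If after an execution $E$ two different transactions $T_1,T_2$ are each poised to apply a primitive to the same base object, at least one of them nontrivial, then $\mathrm{Dset}(T_1)\cap\mathrm{Dset}(T_2)\ne\emptyset$, or a t-object of $\mathrm{Dset}(T_1)$ is connected to one of $\mathrm{Dset}(T_2)$ in the graph in which two t-objects are adjacent if they lie in the data set of one transaction that is $T_1$, $T_2$ or concurrent in $E$ to $T_1$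 or $T_2$. *RAW/AWAR.* A primitive writes if it is nontrivial. It reads unless $h$ is constant and $g$ is the identity or constant. $T$ performs a RAW in a fragment if in it $T$ writes to a base object $b$ and later reads a base object $b'\neq b$, with no write to $b'$ by $T$ in between; it performs an AWAR if it applies a nontrivial primitive that reads. -/

import Mathlib

noncomputable section

universe u v w

namespace TMem

/-- Transaction identifiers. -/
abbrev TxnId := ℕ

/-- The t-operations that a transaction may invoke. -/
inductive Op (X : Type u) (V : Type v) where
  | read (x : X)
  | write (x : X) (a : V)
  | tryC

/-- Responses of t-operations: a value (of a t-read), `ok` (of a t-write), commit, abort. -/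
inductive Ret (V : Type v) where
  | val (a : V)
  | ok
  | commit
  | abort

/-- The responses that a t-operation may have. -/
def Ret.Matches {X : Type u} {V : Type v} : Op X V → Ret V → Prop
  | _, .abort => True
  | .read _, .val _ => True
  | .write _ _, .ok => True
  | .tryC, .commit => True
  | _, _ => False

/-- The responses `C_k` and `A_k`, which end a transaction. -/
def Ret.IsFinal {V : Type v} : Ret V → Prop
  | .commit => True
  | .abort => True
  | _ => False

/-! ### Histories -/

/-- Invocations and responses of t-operations. -/
inductive HEvent (X : Type u) (V : Type v) where
  | inv (k : TxnId) (o : Op X V)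
  | ret (k : TxnId) (r : Ret V)

def HEvent.txn {X : Type u} {V : Type v} : HEvent X V → TxnId
  | .inv k _ => k
  | .ret k _ => k

abbrev History (X : Type u) (V : Type v) := List (HEvent X V)

namespace History

variable {X : Type u} {V : Type v}

/-- `H|k`. -/
def proj (H : History X V) (k : TxnId) : History X V := H.filter (fun e => e.txn = k)

/-- `txns(H)`. -/
def txns (H : History X V) : Set TxnId := {k | ∃ e ∈ H, e.txn = k}

def rset (H : History X V) (k : TxnId) : Set X := {x | .inv k (.read x) ∈ H}

def wset (H : History X V) (k : TxnId) : Set X := {x | ∃ a, .inv k (.write x a) ∈ H}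

def dset (H : History X V) (k : TxnId) : Set X := H.rset k ∪ H.wset k

def ReadOnly (H : History X V) (k : TxnId) : Prop := H.wset k = ∅

def Committed (H : History X V) (k : TxnId) : Prop :=
  (H.proj k).getLast? = some (.ret k .commit)

def Aborted (H : History X V) (k : TxnId) : Prop :=
  (H.proj k).getLast? = some (.ret k .abort)

def TComplete (H : History X V) (k : TxnId) : Prop := H.Committed k ∨ H.Aborted k

/-- Real-time order: `T_k` is t-complete, and its last event precedes the first event of `T_m`
(no event of `T_m` occurs before an event of `T_k`). -/
def Precedes (H : History X V) (k m : TxnId) : Prop :=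
  k ∈ H.txns ∧ m ∈ H.txns ∧ H.TComplete k ∧ H.Pairwise (fun a b => ¬ (a.txn = m ∧ b.txn = k))

def Concurrent (H : History X V) (k m : TxnId) : Prop :=
  k ∈ H.txns ∧ m ∈ H.txns ∧ ¬ H.Precedes k m ∧ ¬ H.Precedes m k

def TSequential (H : History X V) : Prop :=
  ∀ k ∈ H.txns, ∀ m ∈ H.txns, k ≠ m → ¬ H.Concurrent k m

open Classical in
/-- The values written to `x` by the t-writes in `H` of the transactions satisfying `P`,
in order. -/
def writesTo (H : History X V) (P : TxnId → Prop) (x : X) : List V :=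
  H.filterMap fun
    | .inv k (.write y a) => if P k ∧ y = x then some a else none
    | _ => none

/-- The latest written value of `x` for a t-read of `T_k` which returns right after the prefix `S₁`
of the t-sequential history `S`: the latest own write to `x`, otherwise the latest write to `x` by
a committed transaction that precedes `T_k`, otherwise the initial value. -/
def latestWritten (init : X → V) (S S₁ : History X V) (k : TxnId) (x : X) : V :=
  match (S₁.writesTo (fun l => l = k) x).getLast? with
  | some a => a
  | none =>
    ((S₁.writesTo (fun l => S.Committed l ∧ S.Precedes l k) x).getLast?).getD (init x)

/-- Every t-read that returns a value returns the latest written value. -/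
def Legal (init : X → V) (S : History X V) : Prop :=
  ∀ (S₁ S₂ : History X V) (k : TxnId) (x : X) (a : V),
    S = S₁ ++ .ret k (.val a) :: S₂ → (S₁.proj k).getLast? = some (.inv k (.read x)) →
      a = latestWritten init S S₁ k x

/-- `H'` is a completion of `H`: it is obtained from `H` by inserting, for each transaction, the
events that complete it, after its last event. -/
def IsCompletion (H H' : History X V) : Prop :=
  H.Sublist H' ∧ ∀ k : TxnId,
    match (H.proj k).getLast? with
    | none => H'.proj k = []
    | some (.inv _ .tryC) =>
        H'.proj k = H.proj k ++ [.ret k .commit] ∨ H'.proj k = H.proj k ++ [.ret k .abort]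
    | some (.inv _ _) => H'.proj k = H.proj k ++ [.ret k .abort]
    | some (.ret _ r) =>
        (r.IsFinal → H'.proj k = H.proj k) ∧
        (¬ r.IsFinal → H'.proj k = H.proj k ++ [.inv k .tryC, .ret k .abort])

open Classical in
/-- The subsequence of `H` reduced to the committed transactions. -/
def cseq (H : History X V) : History X V :=
  H.filter (fun e => H.Committed e.txn)

/-- Strict serializability of a finite history, where `init` are the values written by the imaginary
initial transaction. -/
def StrictlySerializable (init : X → V) (H : History X V) : Prop :=
  ∃ S H' : History X V,
    (∀ k ∈ S.txns, S.TComplete k) ∧ S.TSequential ∧ S.Legal init ∧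
    (∀ k ∈ S.txns, ∀ m ∈ S.txns, H.Precedes k m → S.Precedes k m) ∧
    H.IsCompletion H' ∧ ∀ k, S.proj k = H'.cseq.proj k

/-- The set of the transactions `T_k`, `T_m` and all those concurrent to at least one of them. -/
def related (H : History X V) (k m : TxnId) : Set TxnId :=
  {l | l = k ∨ l = m ∨ H.Concurrent l k ∨ H.Concurrent l m}

/-- The conflict graph of `T_k` and `T_m`. (T-objects outside its vertex set, which is the union of
the data sets of the related transactions, are isolated here.) -/
def conflictGraph (H : History X V) (k m : TxnId) : SimpleGraph X where
  Adj x y := x ≠ y ∧ ∃ l ∈ H.related k m, x ∈ H.dset l ∧ y ∈ H.dset l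
  symm := ⟨fun _ _ ⟨hne, l, hl, hx, hy⟩ => ⟨hne.symm, l, hl, hy, hx⟩⟩
  loopless := ⟨fun _ h => h.1 rfl⟩

def DisjointAccess (H : History X V) (k m : TxnId) : Prop :=
  ∀ x ∈ H.dset k, ∀ y ∈ H.dset m, ¬ (H.conflictGraph k m).Reachable x y

end History

/-! ### Implementations -/

/-- A read-modify-write primitive on a base object with values in `W`: an update function and a
response function. -/
structure Prim (W : Type w) (R : Type w) where
  upd : W → W
  resp : W → R

namespace Prim

variable {W R : Type w}

def Trivial (f : Prim W R) : Prop := ∀ a, f.upd a = a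

/-- The primitive reads the base object, i.e. its effect depends on the current value. The
primitives that do not read are those with a constant response that either leave the value
unchanged (no-ops) or overwrite it by a fixed value (plain writes). -/
def Reads (f : Prim W R) : Prop :=
  ¬ ((∀ a b, f.resp a = f.resp b) ∧ (f.Trivial ∨ ∀ a b, f.upd a = f.upd b))

end Prim

/-- What a process with a pending t-operation does next: apply a primitive, or respond. -/
inductive Next {Obj : Type w} (Val : Obj → Type w) (R : Type w) (V : Type v) where
  | prim (b : Obj) (f : Prim (Val b) R)
  | ret (r : Ret V)

/-- A TM implementation for `n` processes, with t-objects `X` and domain of values `V`: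
base objects with initial values and, for each process, a deterministic algorithm. -/
structure TM (n : ℕ) (X : Type u) (V : Type v) where
  /-- base objects, their values, and the responses of primitives -/
  Obj : Type w
  Val : Obj → Type w
  Resp : Type w
  /-- local states of processes -/
  State : Type w
  /-- initial values of the base objects, initial local states, initial values of the t-objects -/
  initMem : ∀ b, Val b
  initState : Fin n → State
  initObj : X → V
  /-- the local state after the invocation of a t-operation of a transaction -/
  invoke : State → TxnId → Op X V → State
  /-- what is done next for the pending t-operation -/
  next : State → Op X V → Next Val Resp V
  /-- the local state after a primitive has returned its response -/
  resume : State → Resp → State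
  /-- responses match the invocations -/
  next_matches : ∀ s o r, next s o = .ret r → r.Matches o

/-- The status of a process: between transactions, in a transaction but between t-operations, or
with a pending t-operation. -/
inductive Status (X : Type u) (V : Type v) where
  | free
  | active (k : TxnId)
  | busy (k : TxnId) (o : Op X V)

namespace TM

variable {n : ℕ} {X : Type u} {V : Type v}

/-- Events: invocations and responses of t-operations and RMW events, each labelled with the
process and the transaction that perform it. -/
inductive Event (M : TM.{u, v, w} n X V) where
  | inv (p : Fin n) (k : TxnId) (o : Op X V)
  | ret (p : Fin n) (k : TxnId) (r : Ret V)
  | rmw (p : Fin n) (k : TxnId) (b : M.Obj) (f : Prim (M.Val b) M.Resp) (r : M.Resp)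

variable {M : TM.{u, v, w} n X V}

namespace Event

def txn : M.Event → TxnId
  | .inv _ k _ => k
  | .ret _ k _ => k
  | .rmw _ k _ _ _ => k

def toHEvent : M.Event → Option (HEvent X V)
  | .inv _ k o => some (.inv k o)
  | .ret _ k r => some (.ret k r)
  | .rmw _ _ _ _ _ => none

def IsInv : M.Event → Prop
  | .inv _ _ _ => True
  | _ => False

def IsRet : M.Event → Prop
  | .ret _ _ _ => True
  | _ => False

/-- The event is a RMW event on the base object `b`. -/
def Accesses (b : M.Obj) : M.Event → Prop
  | .rmw _ _ b' _ _ => b' = b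
  | _ => False

/-- The event applies a nontrivial primitive. -/
def Nontrivial : M.Event → Prop
  | .rmw _ _ _ f _ => ¬ f.Trivial
  | _ => False

/-- The event applies a primitive that reads its base object. -/
def Reads : M.Event → Prop
  | .rmw _ _ _ f _ => f.Reads
  | _ => False

/-- The events contend on the base object `b`. -/
def Contend (b : M.Obj) (e e' : M.Event) : Prop :=
  e.Accesses b ∧ e'.Accesses b ∧ (e.Nontrivial ∨ e'.Nontrivial)

end Event

/-- The history exported by an execution. -/
def history (E : List M.Event) : History X V := E.filterMap Event.toHEvent

/-- Configurations: the values of the base objects and the states of the processes, together with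
the status of each process and the set of transaction identifiers used so far. -/
structure Config (M : TM.{u, v, w} n X V) where
  mem : ∀ b, M.Val b
  st : Fin n → M.State
  status : Fin n → Status X V
  used : Set TxnId

def initConfig (M : TM.{u, v, w} n X V) : M.Config where
  mem := M.initMem
  st := M.initState
  status := fun _ => .free
  used := ∅

open Classical in
/-- One event, issued according to the implementation. A process starts a new transaction (with an
unused identifier) only when its previous one is t-complete, and invokes a t-operation only when its
previous one has returned. -/
inductive Step (M : TM.{u, v, w} n X V) : M.Config → M.Event → M.Config → Prop
  | start (c : M.Config) (p : Fin n) (k : TxnId) (o : Op X V)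
      (hp : c.status p = .free) (hk : k ∉ c.used) :
      Step M c (.inv p k o)
        { c with
          st := Function.update c.st p (M.invoke (c.st p) k o)
          status := Function.update c.status p (.busy k o)
          used := insert k c.used }
  | invoke (c : M.Config) (p : Fin n) (k : TxnId) (o : Op X V)
      (hp : c.status p = .active k) :
      Step M c (.inv p k o)
        { c with
          st := Function.update c.st p (M.invoke (c.st p) k o)
          status := Function.update c.status p (.busy k o) }
  | prim (c : M.Config) (p : Fin n) (k : TxnId) (o : Op X V)
      (b : M.Obj) (f : Prim (M.Val b) M.Resp)
      (hp : c.status p = .busy k o) (hn : M.next (c.st p) o = .prim b f) :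
      Step M c (.rmw p k b f (f.resp (c.mem b)))
        { c with
          mem := Function.update c.mem b (f.upd (c.mem b))
          st := Function.update c.st p (M.resume (c.st p) (f.resp (c.mem b))) }
  | ret (c : M.Config) (p : Fin n) (k : TxnId) (o : Op X V) (r : Ret V)
      (hp : c.status p = .busy k o) (hn : M.next (c.st p) o = .ret r) :
      Step M c (.ret p k r)
        { c with
          status := Function.update c.status p (if r.IsFinal then .free else .active k) }

/-- `M.Reaches E c`: the finite sequence of events `E`, issued according to `M` from the initial
configuration, ends in the configuration `c`. -/
inductive Reaches (M : TM.{u, v, w} n X V) : List M.Event → M.Config → Prop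
  | nil : Reaches M [] M.initConfig
  | snoc (E : List M.Event) (c c' : M.Config) (e : M.Event) :
      Reaches M E c → M.Step c e c' → Reaches M (E ++ [e]) c'

/-- Finite executions. -/
def IsExec (M : TM.{u, v, w} n X V) (E : List M.Event) : Prop := ∃ c, M.Reaches E c

/-- The first `N` events of an infinite sequence. -/
def pre (s : ℕ → M.Event) (N : ℕ) : List M.Event := (List.range N).map s

/-- Infinite executions. -/
def IsInfExec (M : TM.{u, v, w} n X V) (s : ℕ → M.Event) : Prop := ∀ N, M.IsExec (pre s N)

/-! ### The class RWF -/

def StrictlySerializable (M : TM.{u, v, w} n X V) : Prop :=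
  ∀ E, M.IsExec E → (history E).StrictlySerializable M.initObj

/-- In the infinite sequence `s`, each t-operation of `T_k` returns within a finite number of steps
of `T_k`: if `T_k` takes infinitely many steps, then each of its invocations is followed by a
response. -/
def OpsReturn (s : ℕ → M.Event) (k : TxnId) : Prop :=
  {i | (s i).txn = k}.Infinite →
    ∀ i, (s i).txn = k → (s i).IsInv → ∃ j, i < j ∧ (s j).txn = k ∧ (s j).IsRet

/-- Wait-free progress for read-only transactions: in every execution, a read-only transaction is
never aborted, and each of its t-operations (hence also `tryC`, with response commit) returns within
a finite number of its own steps. -/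
def WaitFreeReadOnly (M : TM.{u, v, w} n X V) : Prop :=
  (∀ E, M.IsExec E → ∀ k, (history E).ReadOnly k → ¬ (history E).Aborted k) ∧
  (∀ s, M.IsInfExec s → ∀ k, (∀ N, (history (pre s N)).ReadOnly k) → OpsReturn s k)

/-- The configuration after `E` is t-quiescent. -/
def TQuiescent (E : List M.Event) : Prop :=
  ∀ k ∈ (history E).txns, (history E).TComplete k

/-- Sequential progress: a transaction running step contention-free from a t-quiescent configuration
is not aborted, and each of its t-operations (hence also `tryC`, with response commit) returns
within a finite number of steps. -/
def SequentialProgress (M : TM.{u, v, w} n X V) : Prop :=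
  (∀ E ρ : List M.Event, M.IsExec (E ++ ρ) → TQuiescent E →
    ∀ k, (∀ e ∈ ρ, e.txn = k) → ρ ≠ [] → ¬ (history (E ++ ρ)).Aborted k) ∧
  (∀ s, M.IsInfExec s → ∀ N, TQuiescent (pre s N) →
    ∀ k, (∀ i, N ≤ i → (s i).txn = k) → OpsReturn s k)

def RWF (M : TM.{u, v, w} n X V) : Prop :=
  M.StrictlySerializable ∧ M.WaitFreeReadOnly ∧ M.SequentialProgress

/-! ### Weak disjoint-access parallelism -/

/-- `T_k` and `T_m` concurrently contend on `b` after `E`: they are poised to apply events that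
contend on `b`. (RMW events are not chosen by the user: if `E ++ [e]` is an execution and `e` is a
RMW event of `T_k`, then `e` is the enabled event of `T_k` after `E`.) -/
def ConcurrentlyContend (M : TM.{u, v, w} n X V) (E : List M.Event) (k m : TxnId)
    (b : M.Obj) : Prop :=
  ∃ e e' : M.Event, e.txn = k ∧ e'.txn = m ∧ M.IsExec (E ++ [e]) ∧ M.IsExec (E ++ [e']) ∧
    Event.Contend b e e'

def WeakDAP (M : TM.{u, v, w} n X V) : Prop :=
  ∀ E, M.IsExec E → ∀ k m, k ≠ m → ∀ b, M.ConcurrentlyContend E k m b →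
    ¬ (history E).DisjointAccess k m ∨ ((history E).dset k ∩ (history E).dset m).Nonempty

/-! ### Expensive synchronization patterns -/

/-- `T_k` performs a read-after-write in the fragment `π`. -/
def PerformsRAW (π : List M.Event) (k : TxnId) : Prop :=
  ∃ (i j : ℕ) (hij : i < j) (hj : j < π.length) (b b' : M.Obj), b' ≠ b ∧
    (π[i].txn = k ∧ π[i].Accesses b ∧ π[i].Nontrivial) ∧
    (π[j].txn = k ∧ π[j].Accesses b' ∧ π[j].Reads) ∧
    ∀ (l : ℕ) (_ : i < l) (_ : l < j),
      ¬ (π[l].txn = k ∧ π[l].Accesses b' ∧ π[l].Nontrivial)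

/-- `T_k` performs an atomic-write-after-read in the fragment `π`. -/
def PerformsAWAR (π : List M.Event) (k : TxnId) : Prop :=
  ∃ e ∈ π, e.txn = k ∧ e.Nontrivial ∧ e.Reads

/-- `T_k` performs at least `N` RAWs/AWARs in `E`: there are `N` consecutive disjoint fragments of
`E` in each of which `T_k` performs a RAW or an AWAR. -/
def PerformsAtLeast (E : List M.Event) (k : TxnId) (N : ℕ) : Prop :=
  ∃ π : Fin N → List M.Event, (List.ofFn π).flatten <:+: E ∧
    ∀ i, PerformsRAW (π i) k ∨ PerformsAWAR (π i) k

/-! ### Read-only transactions running alone -/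

/-- `α` is the complete step contention-free execution fragment of the t-operation `o` with response
`r`, performed by `T_k` on process `p`. -/
def IsOpFragment (p : Fin n) (k : TxnId) (o : Op X V) (r : Ret V) (α : List M.Event) : Prop :=
  ∃ ρ : List M.Event, (∀ e ∈ ρ, ∃ b f q, e = .rmw p k b f q) ∧
    α = .inv p k o :: (ρ ++ [.ret p k r])

/-- `E` is an execution in which `T_k` (on process `p`) runs alone from the initial configuration,
performs the t-reads of `x 0, …, x (m-1)` in this order and commits. The fragment of the `i`-th
t-read is `α i`. -/
def IsReaderExec (M : TM.{u, v, w} n X V) (p : Fin n) (k : TxnId) {m : ℕ} (x : Fin m → X)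
    (α : Fin m → List M.Event) (E : List M.Event) : Prop :=
  M.IsExec E ∧ (∀ i, ∃ a, IsOpFragment p k (.read (x i)) (.val a) (α i)) ∧
    ∃ γ : List M.Event, IsOpFragment p k .tryC .commit γ ∧ E = (List.ofFn α).flatten ++ γ

end TM

end TMem

end

/-! Existence of the reader execution is wait-freedom: an operation running alone either returns or
yields an infinite execution in which it stays pending. For the lower bound, suppose that the read
of `x` returns `a` without RAW or AWAR, after a prefix `σ` of earlier reads, and let `y` be an
object not yet read.

By `IsOpFragment.split` the read is `lam ++ mu`, where `lam` changes no base object and `mu` begins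
with the first write, if there is one. In `mu` a nontrivial primitive never reads (no AWAR), and a
base object is read only after `mu` itself has written it (no RAW). So `mu` cannot observe the
memory it starts in, and by `Oblivious.transfer` it runs unchanged after the memory has been altered
by others.

Let `ρ` be a solo transaction that writes a new value to `y` and commits, and `β` one that writes
`c₂ ≠ a` to `x` and commits, on two further processes. Weak DAP makes solo runs with disjoint data
sets independent event by event (`indep_of_disjoint`), and independent runs commute
(`Config.Valid.commute`). Hence `ρ` commutes with `σ`, `lam` and `β`, while `β` can run after `σ`,
and so after `lam`, which leaves no trace in memory. The sequences `σ lam β ρ` and `ρ σ lam β` reach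
the same configuration. From there the reader performs `mu`, reads `y` and commits, with identical
responses in both executions.

If `ρ` comes first, the reader must see its value of `y`. In the other execution this value forces
`ρ` before the reader in every serialization; since `β` precedes `ρ` in real time, the reader must
also see `c₂` in `x`. But it returned `a` (`read_eq_of_two_orders`). This contradiction is
`performsRAW_or_performsAWAR`; it needs an unread `y`, so it covers all reads but the last. -/

noncomputable section

universe u v w

namespace TMem

namespace TM

variable {n : ℕ} {X : Type u} {V : Type v} {M : TM.{u, v, w} n X V}

/-! ### Effects of single events, and independence of two events -/

namespace Event

/-- The process that performs the event. -/
def proc : M.Event → Fin n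
  | .inv p _ _ => p
  | .ret p _ _ => p
  | .rmw p _ _ _ _ => p

open Classical in
/-- The effect of an event on the base objects. -/
def memUpd (e : M.Event) (μ : ∀ b, M.Val b) : ∀ b, M.Val b :=
  match e with
  | .rmw _ _ b f _ => Function.update μ b (f.upd (μ b))
  | _ => μ

/-- The effect of an event on the local state of its process. -/
def stUpd (e : M.Event) (s : M.State) : M.State :=
  match e with
  | .inv _ k o => M.invoke s k o
  | .ret _ _ _ => s
  | .rmw _ _ _ _ r => M.resume s r

open Classical in
/-- The effect of an event on the status of its process. -/
def statusUpd (e : M.Event) (s : Status X V) : Status X V :=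
  match e with
  | .inv _ k o => .busy k o
  | .ret _ k r => if r.IsFinal then .free else .active k
  | .rmw _ _ _ _ _ => s

/-- The identifier consumed by an event of a process with status `s`, if any. -/
def newUsed (e : M.Event) (s : Status X V) : Set TxnId :=
  match e, s with
  | .inv _ k _, .free => {k}
  | _, _ => ∅

lemma newUsed_subset (e : M.Event) (s : Status X V) : e.newUsed s ⊆ {e.txn} := by
  cases e <;> cases s <;> simp [newUsed, txn]

/-- The events are performed by different processes and different transactions, and do not
contend. -/
def Indep (e e' : M.Event) : Prop :=
  e.proc ≠ e'.proc ∧ e.txn ≠ e'.txn ∧ ∀ b, ¬ Contend b e e'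

lemma Indep.symm {e e' : M.Event} (h : Indep e e') : Indep e' e :=
  ⟨h.1.symm, h.2.1.symm, fun b ⟨h1, h2, h3⟩ => h.2.2 b ⟨h2, h1, h3.symm⟩⟩

lemma memUpd_of_not_nontrivial {e : M.Event} (h : ¬ e.Nontrivial) (μ : ∀ b, M.Val b) :
    e.memUpd μ = μ := by
  cases e with
  | rmw p k b f r =>
    have h' : f.Trivial := by simpa [Nontrivial] using h
    simp [memUpd, h' (μ b)]
  | _ => rfl

lemma memUpd_apply_of_not_accesses {e : M.Event} {b : M.Obj} (h : ¬ e.Accesses b)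
    (μ : ∀ b, M.Val b) : e.memUpd μ b = μ b := by
  classical
  cases e with
  | rmw p k b' f r =>
    have h' : b ≠ b' := fun hb => h hb.symm
    simp [memUpd, Function.update_of_ne h']
  | _ => rfl

/-- Only the case of two nontrivial events matters, and these would contend if they accessed the
same base object; so they update different components of the memory. -/
lemma Indep.memUpd_comm {e e' : M.Event} (h : Indep e e') (μ : ∀ b, M.Val b) :
    e.memUpd (e'.memUpd μ) = e'.memUpd (e.memUpd μ) := by
  classical
  by_cases h1 : e.Nontrivial
  swap
  · rw [memUpd_of_not_nontrivial h1, memUpd_of_not_nontrivial h1]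
  by_cases h2 : e'.Nontrivial
  swap
  · rw [memUpd_of_not_nontrivial h2, memUpd_of_not_nontrivial h2]
  cases e with
  | rmw p k b f r =>
    cases e' with
    | rmw p' k' b' f' r' =>
      have hb : b ≠ b' := fun hb => h.2.2 b ⟨rfl, hb.symm, Or.inl h1⟩
      simp only [memUpd, Function.update_of_ne hb, Function.update_of_ne hb.symm]
      exact Function.update_comm hb.symm _ _ _
    | _ => rfl
  | _ => rfl

end Event

/-! ### Deterministic runs and commutation -/

namespace Config

open Classical in
/-- The configuration after an event. -/
def apply (c : M.Config) (e : M.Event) : M.Config where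
  mem := e.memUpd c.mem
  st := Function.update c.st e.proc (e.stUpd (c.st e.proc))
  status := Function.update c.status e.proc (e.statusUpd (c.status e.proc))
  used := c.used ∪ e.newUsed (c.status e.proc)

/-- The event may be issued in the configuration. -/
def Enabled (c : M.Config) : M.Event → Prop
  | .inv p k _ => (c.status p = .free ∧ k ∉ c.used) ∨ c.status p = .active k
  | .ret p k r => ∃ o, c.status p = .busy k o ∧ M.next (c.st p) o = .ret r
  | .rmw p k b f r =>
      (∃ o, c.status p = .busy k o ∧ M.next (c.st p) o = .prim b f) ∧ f.resp (c.mem b) = r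

/-- The configuration after a sequence of events. -/
def run (c : M.Config) (E : List M.Event) : M.Config := E.foldl apply c

/-- The sequence of events may be issued from the configuration. -/
def Valid : M.Config → List M.Event → Prop
  | _, [] => True
  | c, e :: E => c.Enabled e ∧ (c.apply e).Valid E

@[simp] lemma run_nil (c : M.Config) : c.run [] = c := rfl

@[simp] lemma run_cons (c : M.Config) (e : M.Event) (E : List M.Event) :
    c.run (e :: E) = (c.apply e).run E := rfl

@[simp] lemma run_append (c : M.Config) (E E' : List M.Event) :
    c.run (E ++ E') = (c.run E).run E' := List.foldl_append

@[simp] lemma valid_nil (c : M.Config) : c.Valid [] := trivial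

@[simp] lemma valid_cons (c : M.Config) (e : M.Event) (E : List M.Event) :
    c.Valid (e :: E) ↔ c.Enabled e ∧ (c.apply e).Valid E := Iff.rfl

@[simp] lemma valid_append (c : M.Config) (E E' : List M.Event) :
    c.Valid (E ++ E') ↔ c.Valid E ∧ (c.run E).Valid E' := by
  induction E generalizing c with
  | nil => simp
  | cons e E ih => simp [ih, and_assoc]

lemma eq_of_fields {c d : M.Config} (h1 : c.mem = d.mem) (h2 : c.st = d.st)
    (h3 : c.status = d.status) (h4 : c.used = d.used) : c = d := by
  cases c; cases d; simp_all

@[simp] lemma apply_st_self (c : M.Config) (e : M.Event) :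
    (c.apply e).st e.proc = e.stUpd (c.st e.proc) := by simp [apply]

@[simp] lemma apply_status_self (c : M.Config) (e : M.Event) :
    (c.apply e).status e.proc = e.statusUpd (c.status e.proc) := by simp [apply]

lemma apply_st_of_ne (c : M.Config) {e : M.Event} {p : Fin n} (h : e.proc ≠ p) :
    (c.apply e).st p = c.st p := by simp [apply, Function.update_of_ne h.symm]

lemma apply_status_of_ne (c : M.Config) {e : M.Event} {p : Fin n} (h : e.proc ≠ p) :
    (c.apply e).status p = c.status p := by simp [apply, Function.update_of_ne h.symm]

lemma mem_used_apply_of_ne (c : M.Config) {e : M.Event} {k : TxnId} (h : e.txn ≠ k) :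
    k ∈ (c.apply e).used ↔ k ∈ c.used := by
  have := e.newUsed_subset (c.status e.proc)
  simp only [apply, Set.mem_union, or_iff_left_iff_imp]
  intro hk
  exact absurd (this hk).symm h

lemma run_of_ne (c : M.Config) {E : List M.Event} {p : Fin n} (h : ∀ e ∈ E, e.proc ≠ p) :
    (c.run E).st p = c.st p ∧ (c.run E).status p = c.status p := by
  induction E generalizing c with
  | nil => simp
  | cons e E ih =>
    have h1 := h e (by simp)
    have h2 := ih (c.apply e) (fun e' he' => h e' (by simp [he']))
    rw [run_cons, h2.1, h2.2, apply_st_of_ne c h1, apply_status_of_ne c h1]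
    simp

lemma mem_used_run_of_ne (c : M.Config) {E : List M.Event} {k : TxnId}
    (h : ∀ e ∈ E, e.txn ≠ k) : k ∈ (c.run E).used ↔ k ∈ c.used := by
  induction E generalizing c with
  | nil => simp
  | cons e E ih =>
    rw [run_cons, ih (c.apply e) (fun e' he' => h e' (by simp [he'])),
      mem_used_apply_of_ne c (h e (by simp))]

lemma run_mem_of_not_nontrivial (c : M.Config) {E : List M.Event}
    (h : ∀ e ∈ E, ¬ e.Nontrivial) : (c.run E).mem = c.mem := by
  induction E generalizing c with
  | nil => simp
  | cons e E ih =>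
    rw [run_cons, ih (c.apply e) (fun e' he' => h e' (by simp [he']))]
    exact Event.memUpd_of_not_nontrivial (h e (by simp)) _

/-- For a primitive only the response has to agree, not the value of the base object. This is what
allows a plain write to be replayed on an object whose value has changed. -/
lemma Enabled.congr {c d : M.Config} {e : M.Event} (h : c.Enabled e)
    (hst : d.st e.proc = c.st e.proc) (hstatus : d.status e.proc = c.status e.proc)
    (hused : e.IsInv → e.txn ∈ d.used → e.txn ∈ c.used)
    (hresp : ∀ p k b f r, e = .rmw p k b f r → f.resp (d.mem b) = f.resp (c.mem b)) :
    d.Enabled e := by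
  cases e with
  | inv p k o =>
    simp only [Event.proc, Event.txn, Event.IsInv, Enabled, true_implies] at *
    rw [hstatus]
    tauto
  | ret p k r =>
    simp only [Event.proc, Enabled] at *
    rwa [hst, hstatus]
  | rmw p k b f r =>
    simp only [Event.proc, Enabled] at *
    rw [hst, hstatus, hresp p k b f r rfl]
    exact h

/-- The other event could interfere only through the base object that `e` accesses. Without
contention it either leaves the memory unchanged or does not touch that object. -/
lemma Enabled.apply_of_indep {c : M.Config} {e e' : M.Event} (h : c.Enabled e)
    (hi : Event.Indep e e') : (c.apply e').Enabled e := by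
  refine h.congr (c.apply_st_of_ne hi.1.symm) (c.apply_status_of_ne hi.1.symm)
    (fun _ => (c.mem_used_apply_of_ne hi.2.1.symm).1) ?_
  rintro p k b f r rfl
  by_cases h1 : e'.Nontrivial
  · have h2 : ¬ e'.Accesses b := fun h2 => hi.2.2 b ⟨rfl, h2, Or.inr h1⟩
    simp only [apply, Event.memUpd_apply_of_not_accesses h2]
  · simp only [apply, Event.memUpd_of_not_nontrivial h1]

lemma apply_comm (c : M.Config) {e e' : M.Event} (h : Event.Indep e e') :
    (c.apply e).apply e' = (c.apply e').apply e := by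
  have hp := h.1
  refine eq_of_fields ?_ ?_ ?_ ?_
  · exact h.symm.memUpd_comm c.mem
  · simp only [apply, Function.update_of_ne hp, Function.update_of_ne hp.symm]
    exact Function.update_comm hp _ _ _
  · simp only [apply, Function.update_of_ne hp, Function.update_of_ne hp.symm]
    exact Function.update_comm hp _ _ _
  · simp only [apply, Function.update_of_ne hp, Function.update_of_ne hp.symm]
    exact Set.union_right_comm _ _ _

lemma Valid.commute_event {c : M.Config} {e : M.Event} {B : List M.Event}
    (hi : ∀ e' ∈ B, Event.Indep e e') (he : c.Enabled e) (hB : c.Valid B) :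
    (c.apply e).Valid B ∧ (c.run B).Enabled e ∧ (c.apply e).run B = (c.run B).apply e := by
  induction B generalizing c with
  | nil => simpa using he
  | cons e' B ih =>
    have h1 := hi e' (by simp)
    obtain ⟨h2, h3, h4⟩ := ih (fun e'' h => hi e'' (by simp [h])) (he.apply_of_indep h1) hB.2
    rw [valid_cons, run_cons, run_cons, apply_comm c h1]
    exact ⟨⟨hB.1.apply_of_indep h1.symm, h2⟩, h3, h4⟩

/-- Pairwise independent sequences of events commute. -/
lemma Valid.commute {c : M.Config} {A B : List M.Event}
    (hi : ∀ e ∈ A, ∀ e' ∈ B, Event.Indep e e') (hA : c.Valid A) (hB : c.Valid B) :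
    (c.run A).Valid B ∧ (c.run B).Valid A ∧ (c.run A).run B = (c.run B).run A := by
  induction A generalizing c with
  | nil => simpa using hB
  | cons e A ih =>
    obtain ⟨h1, h2, h3⟩ := Valid.commute_event (hi e (by simp)) hA.1 hB
    obtain ⟨h4, h5, h6⟩ := ih (fun e' h => hi e' (by simp [h])) hA.2 h1
    rw [h3] at h5 h6
    exact ⟨h4, ⟨h2, h5⟩, h6⟩

/-- A process does not notice events of other processes which leave the base objects unchanged. -/
lemma Valid.congr {c d : M.Config} {B : List M.Event} {q : Fin n} {l : TxnId}
    (hB : c.Valid B) (hq : ∀ e ∈ B, e.proc = q ∧ e.txn = l) (hmem : d.mem = c.mem)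
    (hst : d.st q = c.st q) (hstatus : d.status q = c.status q)
    (hused : l ∈ d.used ↔ l ∈ c.used) : d.Valid B := by
  induction B generalizing c d with
  | nil => trivial
  | cons e B ih =>
    obtain ⟨rfl, rfl⟩ := hq e (by simp)
    refine ⟨hB.1.congr hst hstatus (fun _ => hused.1) ?_, ih hB.2 ?_ ?_ ?_ ?_ ?_⟩
    · rintro p k b f r rfl
      rw [hmem]
    · exact fun e' h => hq e' (by simp [h])
    · simp only [apply, hmem]
    · rw [apply_st_self, apply_st_self, hst]
    · rw [apply_status_self, apply_status_self, hstatus]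
    · simp only [apply, Set.mem_union, hused, hstatus]

end Config

/-- The event determines the successor configuration, so the step relation is the function `apply`
guarded by `Enabled`. Executions thereby become valid lists, and configurations become folds over
them. -/
lemma step_iff {c c' : M.Config} {e : M.Event} :
    M.Step c e c' ↔ c.Enabled e ∧ c' = c.apply e := by
  constructor
  · intro h
    cases h with
    | start p k o hp hk =>
      refine ⟨Or.inl ⟨hp, hk⟩, Config.eq_of_fields rfl rfl rfl ?_⟩
      simp [Config.apply, Event.proc, hp, Event.newUsed]
    | invoke p k o hp =>
      refine ⟨Or.inr hp, Config.eq_of_fields rfl rfl rfl ?_⟩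
      simp [Config.apply, Event.proc, hp, Event.newUsed]
    | prim p k o b f hp hn =>
      refine ⟨⟨⟨o, hp, hn⟩, rfl⟩, Config.eq_of_fields rfl rfl ?_ ?_⟩ <;>
      simp [Config.apply, Event.proc, Event.newUsed, Event.statusUpd]
    | ret p k o r hp hn =>
      refine ⟨⟨o, hp, hn⟩, Config.eq_of_fields rfl ?_ rfl ?_⟩ <;>
      simp [Config.apply, Event.proc, Event.newUsed, Event.stUpd]
  · rintro ⟨h, rfl⟩
    cases e with
    | inv p k o =>
      rcases h with ⟨hp, hk⟩ | hp
      · convert Step.start c p k o hp hk using 1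
        refine Config.eq_of_fields rfl rfl rfl ?_
        simp [Config.apply, Event.proc, hp, Event.newUsed]
      · convert Step.invoke c p k o hp using 1
        refine Config.eq_of_fields rfl rfl rfl ?_
        simp [Config.apply, Event.proc, hp, Event.newUsed]
    | ret p k r =>
      obtain ⟨o, hp, hn⟩ := h
      convert Step.ret c p k o r hp hn using 1
      refine Config.eq_of_fields rfl ?_ rfl ?_ <;>
      simp [Config.apply, Event.proc, Event.newUsed, Event.stUpd]
    | rmw p k b f r =>
      obtain ⟨⟨o, hp, hn⟩, rfl⟩ := h
      convert Step.prim c p k o b f hp hn using 1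
      refine Config.eq_of_fields rfl rfl ?_ ?_ <;>
      simp [Config.apply, Event.proc, Event.newUsed, Event.statusUpd]

lemma reaches_iff {E : List M.Event} {c : M.Config} :
    M.Reaches E c ↔ M.initConfig.Valid E ∧ c = M.initConfig.run E := by
  constructor
  · intro h
    induction h with
    | nil => simp
    | snoc E c c' e _ hs ih =>
      obtain ⟨h1, rfl⟩ := ih
      obtain ⟨h2, rfl⟩ := step_iff.1 hs
      simp [h1, h2]
  · rintro ⟨h, rfl⟩
    induction E using List.reverseRecOn with
    | nil => exact .nil
    | append_singleton E e ih =>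
      simp only [Config.valid_append, Config.valid_cons, Config.valid_nil, and_true] at h
      refine .snoc E _ _ e (ih h.1) (step_iff.2 ⟨h.2, ?_⟩)
      simp

lemma isExec_iff {E : List M.Event} : M.IsExec E ↔ M.initConfig.Valid E := by
  simp [IsExec, reaches_iff]

end TM

/-! ### Histories of executions, and independence from weak DAP -/

namespace TM

variable {n : ℕ} {X : Type u} {V : Type v} {M : TM.{u, v, w} n X V}

lemma toHEvent_txn {e : M.Event} {h : HEvent X V} (he : e.toHEvent = some h) :
    h.txn = e.txn := by
  cases e <;> simp [Event.toHEvent] at he <;> subst he <;> rfl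

@[simp] lemma history_nil : history ([] : List M.Event) = [] := rfl

@[simp] lemma history_append (E E' : List M.Event) :
    history (E ++ E') = history E ++ history E' := List.filterMap_append

@[simp] lemma history_inv_cons (p : Fin n) (k : TxnId) (o : Op X V) (E : List M.Event) :
    history (.inv p k o :: E) = .inv k o :: history E := rfl

@[simp] lemma history_ret_cons (p : Fin n) (k : TxnId) (r : Ret V) (E : List M.Event) :
    history (.ret p k r :: E) = .ret k r :: history E := rfl

lemma txn_of_mem_history {E : List M.Event} {P : TxnId → Prop} (hE : ∀ e ∈ E, P e.txn)
    {h : HEvent X V} (hh : h ∈ history E) : P h.txn := by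
  obtain ⟨e, he, heh⟩ := List.mem_filterMap.1 hh
  rw [toHEvent_txn heh]
  exact hE e he

end TM

namespace History

variable {X : Type u} {V : Type v}

lemma txn_mem_of_mem_dset {H : History X V} {k : TxnId} {x : X} (hx : x ∈ H.dset k) :
    k ∈ H.txns := by
  rcases hx with hx | ⟨a, hx⟩
  · exact ⟨_, hx, rfl⟩
  · exact ⟨_, hx, rfl⟩

/-- If only two transactions with disjoint data sets occur, then they are disjoint-access. -/
lemma disjointAccess_of_disjoint {H : History X V} {k m : TxnId}
    (ht : ∀ l ∈ H.txns, l = k ∨ l = m) (hd : Disjoint (H.dset k) (H.dset m)) :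
    H.DisjointAccess k m := by
  rintro x hx y hy ⟨p⟩
  -- Each edge lies in the data set of `k` or of `m`. A vertex in the data set of `k` is not in that
  -- of `m`, so a walk that starts in the data set of `k` never leaves it.
  have key : ∀ {x y : X}, (H.conflictGraph k m).Walk x y → x ∈ H.dset k → y ∈ H.dset k := by
    intro x y p
    induction p with
    | nil => exact id
    | cons h _ ih =>
      intro hx
      obtain ⟨-, l, -, h1, h2⟩ := h
      rcases ht l (txn_mem_of_mem_dset h1) with rfl | rfl
      · exact ih h2
      · exact absurd h1 (Set.disjoint_left.1 hd hx)
  exact Set.disjoint_left.1 hd (key p hx) hy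

end History

namespace TM

variable {n : ℕ} {X : Type u} {V : Type v} {M : TM.{u, v, w} n X V}

lemma dset_append_left {E E' : List M.Event} {k : TxnId} (h : ∀ e ∈ E', e.txn ≠ k) :
    (history (E ++ E')).dset k = (history E).dset k := by
  have h1 : ∀ o, HEvent.inv k o ∉ history E' := fun o ho =>
    txn_of_mem_history (P := fun l => l ≠ k) h ho rfl
  ext x
  simp [History.dset, History.rset, History.wset, h1]

lemma dset_append_right {E E' : List M.Event} {k : TxnId} (h : ∀ e ∈ E, e.txn ≠ k) :
    (history (E ++ E')).dset k = (history E').dset k := by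
  have h1 : ∀ o, HEvent.inv k o ∉ history E := fun o ho =>
    txn_of_mem_history (P := fun l => l ≠ k) h ho rfl
  ext x
  simp [History.dset, History.rset, History.wset, h1]

lemma dset_mono {E E' : List M.Event} (h : E <+: E') (k : TxnId) :
    (history E).dset k ⊆ (history E').dset k := by
  obtain ⟨F, rfl⟩ := h
  intro x hx
  simp only [History.dset, History.rset, History.wset, history_append, List.mem_append,
    Set.mem_union, Set.mem_ofPred_eq] at hx ⊢
  rcases hx with hx | ⟨a, hx⟩
  · exact Or.inl (Or.inl hx)
  · exact Or.inr ⟨a, Or.inl hx⟩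

/-- All events of `A` are performed by the transaction `k` on the process `p`. -/
def Solo (p : Fin n) (k : TxnId) (A : List M.Event) : Prop := ∀ e ∈ A, e.proc = p ∧ e.txn = k

lemma Solo.append {p : Fin n} {k : TxnId} {A B : List M.Event} (hA : Solo p k A)
    (hB : Solo p k B) : Solo p k (A ++ B) := fun e he =>
  (List.mem_append.1 he).elim (hA e) (hB e)

lemma Solo.left {p : Fin n} {k : TxnId} {A B : List M.Event} (h : Solo p k (A ++ B)) :
    Solo p k A := fun e he => h e (List.mem_append_left _ he)

lemma Solo.right {p : Fin n} {k : TxnId} {A B : List M.Event} (h : Solo p k (A ++ B)) :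
    Solo p k B := fun e he => h e (List.mem_append_right _ he)

lemma Solo.proc_ne {p q : Fin n} {k : TxnId} {A : List M.Event} (h : Solo p k A) (hpq : p ≠ q) :
    ∀ e ∈ A, e.proc ≠ q := fun e he => by rw [(h e he).1]; exact hpq

lemma Solo.txn_ne {p : Fin n} {k l : TxnId} {A : List M.Event} (h : Solo p k A) (hkl : k ≠ l) :
    ∀ e ∈ A, e.txn ≠ l := fun e he => by rw [(h e he).2]; exact hkl

section DisjointSolo

variable {p q : Fin n} {k m : TxnId}

/-- The events of two transactions with disjoint data sets that are enabled in the same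
configuration are independent, if no other transaction has started. -/
lemma indep_of_enabled (hDAP : M.WeakDAP) (hpq : p ≠ q) (hkm : k ≠ m) {A B : List M.Event}
    {e e' : M.Event} (hA : Solo p k (A ++ [e])) (hB : Solo q m (B ++ [e']))
    (hd : Disjoint ((history (A ++ [e])).dset k) ((history (B ++ [e'])).dset m))
    (hAB : M.IsExec (A ++ B)) (he : (M.initConfig.run (A ++ B)).Enabled e)
    (he' : (M.initConfig.run (A ++ B)).Enabled e') : Event.Indep e e' := by
  have h1 := hA e (by simp)
  have h2 := hB e' (by simp)
  refine ⟨by rw [h1.1, h2.1]; exact hpq, by rw [h1.2, h2.2]; exact hkm, fun b hb => ?_⟩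
  have hk : (history (A ++ B)).dset k ⊆ (history (A ++ [e])).dset k := by
    rw [dset_append_left (hB.left.txn_ne hkm.symm)]
    exact dset_mono (List.prefix_append _ _) k
  have hm : (history (A ++ B)).dset m ⊆ (history (B ++ [e'])).dset m := by
    rw [dset_append_right (hA.left.txn_ne hkm)]
    exact dset_mono (List.prefix_append _ _) m
  have hd' := hd.mono hk hm
  have hex : ∀ g, (M.initConfig.run (A ++ B)).Enabled g → M.IsExec (A ++ B ++ [g]) := fun g hg =>
    isExec_iff.2 ((Config.valid_append _ _ _).2 ⟨isExec_iff.1 hAB, hg, trivial⟩)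
  rcases hDAP _ hAB k m hkm b ⟨e, e', h1.2, h2.2, hex e he, hex e' he', hb⟩ with h | h
  · refine h (History.disjointAccess_of_disjoint ?_ hd')
    rintro l ⟨g, hg, rfl⟩
    refine txn_of_mem_history (P := fun l => l = k ∨ l = m) ?_ hg
    intro e he
    rcases List.mem_append.1 he with he | he
    · exact Or.inl (hA.left e he).2
    · exact Or.inr (hB.left e he).2
  · exact Set.not_nonempty_iff_eq_empty.2 (Set.disjoint_iff_inter_eq_empty.1 hd') h

/-- Double induction on the lengths. The smaller cases show that the last events of both runs are
enabled after the two shortened runs; weak DAP then makes these events independent, and swapping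
them closes the square. -/
lemma exec_commute_of_disjoint (hDAP : M.WeakDAP) (hpq : p ≠ q) (hkm : k ≠ m)
    {A B : List M.Event} (hA : M.IsExec A) (hB : M.IsExec B) (hsA : Solo p k A) (hsB : Solo q m B)
    (hd : Disjoint ((history A).dset k) ((history B).dset m)) :
    M.IsExec (A ++ B) ∧ M.IsExec (B ++ A) ∧
      M.initConfig.run (A ++ B) = M.initConfig.run (B ++ A) := by
  induction A using List.reverseRecOn generalizing B with
  | nil => simpa using hB
  | append_singleton A e ihA =>
    induction B using List.reverseRecOn with
    | nil => simpa using hA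
    | append_singleton B e' ihB =>
      have hA' : M.IsExec A := by rw [isExec_iff, Config.valid_append] at *; exact hA.1
      have hB' : M.IsExec B := by rw [isExec_iff, Config.valid_append] at *; exact hB.1
      have dA := dset_mono (List.prefix_append A [e]) k
      have dB := dset_mono (List.prefix_append B [e']) m
      obtain ⟨h1, h2, h3⟩ := ihA hA' hB hsA.left hsB (hd.mono_left dA)
      obtain ⟨h4, h5, h6⟩ := ihB hB' hsB.left (hd.mono_right dB)
      obtain ⟨h7, h8, h9⟩ := ihA hA' hB' hsA.left hsB.left (hd.mono dA dB)
      simp only [isExec_iff, Config.valid_append, Config.run_append, Config.valid_cons,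
        Config.valid_nil, Config.run_cons, Config.run_nil, and_true] at *
      have he := h5.2.2
      rw [← h9] at he
      have hi := indep_of_enabled hDAP hpq hkm hsA hsB hd (by simp [isExec_iff, h7])
        (by simpa using he) (by simpa using h1.2.2)
      have h10 := h1.2.2.apply_of_indep hi.symm
      have h11 := he.apply_of_indep hi
      rw [h9] at h10
      rw [h6, ← h3]
      refine ⟨⟨hA, h4.2, h10⟩, ⟨hB, h2.2, h11⟩, ?_⟩
      rw [← h9, Config.apply_comm _ hi]

/-- Under weak DAP, solo executions of transactions with disjoint data sets are independent. -/
lemma indep_of_disjoint (hDAP : M.WeakDAP) (hpq : p ≠ q) (hkm : k ≠ m)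
    {A B : List M.Event} (hA : M.IsExec A) (hB : M.IsExec B) (hsA : Solo p k A) (hsB : Solo q m B)
    (hd : Disjoint ((history A).dset k) ((history B).dset m)) :
    ∀ e ∈ A, ∀ e' ∈ B, Event.Indep e e' := by
  intro e he e' he'
  obtain ⟨A₁, A₂, rfl⟩ := List.append_of_mem he
  obtain ⟨B₁, B₂, rfl⟩ := List.append_of_mem he'
  rw [List.append_cons A₁] at hA hsA hd
  rw [List.append_cons B₁] at hB hsB hd
  rw [isExec_iff, Config.valid_append, ← isExec_iff] at hA hB
  have dA := dset_mono (List.prefix_append (A₁ ++ [e]) A₂) k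
  have dB := dset_mono (List.prefix_append (B₁ ++ [e']) B₂) m
  have hd' := hd.mono dA dB
  have dA' := dset_mono (List.prefix_append A₁ [e]) k
  have dB' := dset_mono (List.prefix_append B₁ [e']) m
  have hA₁ : M.IsExec A₁ := by rw [isExec_iff, Config.valid_append] at *; exact hA.1.1
  have hB₁ : M.IsExec B₁ := by rw [isExec_iff, Config.valid_append] at *; exact hB.1.1
  -- Cutting both runs just before `e` and `e'` and commuting the pieces brings both events into the
  -- position of being enabled after `A₁ ++ B₁`.
  obtain ⟨h1, -, -⟩ := exec_commute_of_disjoint hDAP hpq hkm hA₁ hB.1 hsA.left.left hsB.left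
    (hd'.mono_left dA')
  obtain ⟨-, h2, -⟩ := exec_commute_of_disjoint hDAP hpq hkm hA.1 hB₁ hsA.left hsB.left.left
    (hd'.mono_right dB')
  obtain ⟨h3, -, h4⟩ := exec_commute_of_disjoint hDAP hpq hkm hA₁ hB₁ hsA.left.left
    hsB.left.left (hd'.mono dA' dB')
  rw [isExec_iff] at h1 h2
  simp only [Config.valid_append, Config.valid_cons, Config.valid_nil, and_true] at h1 h2
  refine indep_of_enabled hDAP hpq hkm hsA.left hsB.left hd' h3 ?_ ?_
  · rw [h4]
    simpa using h2.2.2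
  · simpa using h1.2.2

end DisjointSolo

/-! ### Fragments without RAW and AWAR -/

/-- The fragment has no invocations, its nontrivial events do not read, and each base object that it
reads is in `W` or has been written in the fragment before. -/
def Oblivious : Set M.Obj → List M.Event → Prop
  | _, [] => True
  | W, e :: E => ¬ e.IsInv ∧ (∀ b, e.Accesses b → e.Reads → b ∈ W) ∧ (e.Nontrivial → ¬ e.Reads) ∧
      Oblivious (W ∪ {b | e.Accesses b ∧ e.Nontrivial}) E

/-- The part of a fragment without RAW and AWAR that follows a nontrivial event is oblivious. -/
lemma oblivious_of_not_raw {k : TxnId} {L pre suf : List M.Event} (hL : L = pre ++ suf)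
    (hk : ∀ e ∈ L, e.txn = k) (hraw : ¬ PerformsRAW L k) (hawar : ¬ PerformsAWAR L k)
    (hinv : ∀ e ∈ suf, ¬ e.IsInv) (hpre : ∃ e ∈ pre, e.Nontrivial) :
    Oblivious {b | ∃ e ∈ pre, e.Accesses b ∧ e.Nontrivial} suf := by
  induction suf generalizing pre with
  | nil => trivial
  | cons e suf ih =>
    have heL : e ∈ L := by simp [hL]
    refine ⟨hinv e (by simp), ?_, fun h1 h2 => hawar ⟨e, heL, hk e heL, h1, h2⟩, ?_⟩
    · intro b hb hr
      -- If `b` has not been written before, any earlier nontrivial event acts on another object,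
      -- and together with this read of `b` it forms a RAW.
      by_contra hbW
      obtain ⟨e₀, he₀, hn₀⟩ := hpre
      obtain ⟨i, hi, rfl⟩ := List.getElem_of_mem he₀
      have hacc : ∃ b₀, (pre[i]).Accesses b₀ := by
        cases h : pre[i] with
        | rmw p k b f r => exact ⟨b, rfl⟩
        | _ => rw [h] at hn₀; exact hn₀.elim
      obtain ⟨b₀, hb₀⟩ := hacc
      subst hL
      refine hraw ⟨i, pre.length, hi, by simp, b₀, b, ?_, ?_, ?_, ?_⟩
      · rintro rfl
        exact hbW ⟨_, he₀, hb₀, hn₀⟩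
      · rw [List.getElem_append_left hi]
        exact ⟨hk _ (by simp), hb₀, hn₀⟩
      · simpa using ⟨hk e heL, hb, hr⟩
      · rintro l - hl ⟨-, h1, h2⟩
        rw [List.getElem_append_left hl] at h1 h2
        exact hbW ⟨_, List.getElem_mem hl, h1, h2⟩
    · have := ih (pre := pre ++ [e]) (by simp [hL]) (fun e' h => hinv e' (by simp [h]))
        (hpre.imp fun e' h => ⟨List.mem_append_left _ h.1, h.2⟩)
      convert this using 1
      ext b
      simp only [List.mem_append, List.mem_singleton, Set.mem_union, Set.mem_ofPred_eq]
      constructor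
      · rintro (⟨e', h1, h2⟩ | h)
        · exact ⟨e', Or.inl h1, h2⟩
        · exact ⟨e, Or.inr rfl, h⟩
      · rintro ⟨e', h1 | rfl, h2⟩
        · exact Or.inl ⟨e', h1, h2⟩
        · exact Or.inr h2

lemma exists_split_at_nontrivial (E : List M.Event) :
    ∃ T mu, E = T ++ mu ∧ (∀ e ∈ T, ¬ e.Nontrivial) ∧ ∀ e mu', mu = e :: mu' → e.Nontrivial := by
  induction E with
  | nil => exact ⟨[], [], by simp⟩
  | cons e E ih =>
    by_cases h : e.Nontrivial
    · exact ⟨[], e :: E, rfl, by simp, fun e' mu' h' => by rw [List.cons.injEq] at h'; rwa [← h'.1]⟩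
    · obtain ⟨T, mu, rfl, h1, h2⟩ := ih
      exact ⟨e :: T, mu, rfl, by simpa [h] using h1, h2⟩

/-- An operation fragment without RAW and AWAR consists of a part without nontrivial events and an
oblivious part. -/
lemma IsOpFragment.split {p : Fin n} {k : TxnId} {o : Op X V} {r : Ret V} {L : List M.Event}
    (hL : IsOpFragment p k o r L) (hraw : ¬ PerformsRAW L k) (hawar : ¬ PerformsAWAR L k) :
    ∃ lam mu, L = lam ++ mu ∧ (∀ e ∈ lam, ¬ e.Nontrivial) ∧ Oblivious ∅ mu := by
  obtain ⟨ρ, hρ, rfl⟩ := hL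
  obtain ⟨T, mu, hsplit, hT, hmu⟩ := exists_split_at_nontrivial (ρ ++ [Event.ret p k r])
  have hall : ∀ e ∈ ρ ++ [Event.ret p k r], e.txn = k ∧ ¬ e.IsInv := by
    intro e he
    simp only [List.mem_append, List.mem_singleton] at he
    rcases he with he | rfl
    · obtain ⟨b, f, q, rfl⟩ := hρ e he
      exact ⟨rfl, id⟩
    · exact ⟨rfl, id⟩
  rw [hsplit] at hraw hawar hall ⊢
  have hk : ∀ e ∈ Event.inv p k o :: (T ++ mu), e.txn = k := by
    intro e he
    rcases List.mem_cons.1 he with rfl | he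
    · rfl
    · exact (hall e he).1
  have hlam : ∀ e ∈ Event.inv p k o :: T, ¬ e.Nontrivial := by
    intro e he
    rcases List.mem_cons.1 he with rfl | he
    · exact id
    · exact hT e he
  refine ⟨.inv p k o :: T, mu, rfl, hlam, ?_⟩
  cases mu with
  | nil => trivial
  | cons e mu =>
    have hn : e.Nontrivial := hmu e mu rfl
    have hmu' : ∀ e' ∈ e :: mu, e' ∈ T ++ e :: mu := fun e' h => List.mem_append_right _ h
    have heR : ¬ e.Reads := fun h =>
      hawar ⟨e, List.mem_cons_of_mem _ (hmu' e (by simp)), (hall e (by simp)).1, hn, h⟩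
    -- The first nontrivial event does not read, since otherwise it would be an AWAR. Hence `mu` is
    -- oblivious even for the empty set of known objects.
    refine ⟨(hall e (by simp)).2, fun b _ h => absurd h heR, fun _ => heR, ?_⟩
    have key := oblivious_of_not_raw (pre := (.inv p k o :: T) ++ [e]) (suf := mu)
      (by simp) hk hraw hawar (fun e' h => (hall e' (by simp [h])).2) ⟨e, by simp, hn⟩
    convert key using 1
    ext b
    constructor
    · rintro (h | h)
      · exact h.elim
      · exact ⟨e, by simp, h⟩
    · rintro ⟨e', he', h1, h2⟩
      rcases List.mem_append.1 he' with h | h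
      · exact absurd h2 (hlam e' h)
      · rw [List.mem_singleton] at h
        subst h
        exact Or.inr ⟨h1, h2⟩

/-- An oblivious fragment of a process can be performed in any configuration in which the state of
the process and the base objects in `W` are the same. -/
lemma Oblivious.transfer {p : Fin n} {k : TxnId} {W : Set M.Obj} {E : List M.Event}
    (hE : Oblivious W E) (hs : Solo p k E) {c d : M.Config} (hc : c.Valid E)
    (hst : d.st p = c.st p) (hstatus : d.status p = c.status p)
    (hW : ∀ b ∈ W, d.mem b = c.mem b) :
    d.Valid E ∧ (d.run E).status p = (c.run E).status p := by
  induction E generalizing c d W with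
  | nil => exact ⟨trivial, hstatus⟩
  | cons e E ih =>
    obtain ⟨h1, h2, h3, h4⟩ := hE
    obtain ⟨rfl, rfl⟩ := hs e (by simp)
    have hresp : ∀ p k b f r, e = .rmw p k b f r → f.resp (d.mem b) = f.resp (c.mem b) := by
      rintro p k b f r rfl
      by_cases hr : f.Reads
      · rw [hW b (h2 b rfl hr)]
      · exact (not_not.1 hr).1 _ _
    -- A nontrivial primitive that does not read has a constant update, so after it the two memories
    -- agree on the written object whatever they held before. The set of known objects may therefore
    -- grow.
    have hmem : ∀ b ∈ W ∪ {b | e.Accesses b ∧ e.Nontrivial},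
        (d.apply e).mem b = (c.apply e).mem b := by
      rintro b hb
      by_cases hn : e.Nontrivial
      · by_cases ha : e.Accesses b
        · cases e with
          | rmw p k b' f r =>
            obtain rfl : b' = b := ha
            have := (not_not.1 (h3 hn)).2.resolve_left hn
            simp only [Config.apply, Event.memUpd, Function.update_self]
            exact this _ _
          | _ => exact hn.elim
        · simp only [Config.apply, Event.memUpd_apply_of_not_accesses ha]
          exact hW b (hb.resolve_right fun h => ha h.1)
      · simp only [Config.apply, Event.memUpd_of_not_nontrivial hn]
        exact hW b (hb.resolve_right fun h => hn h.2)
    have := ih h4 (fun e' h => hs e' (by simp [h])) hc.2 (d := d.apply e)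
      (by rw [Config.apply_st_self, Config.apply_st_self, hst])
      (by rw [Config.apply_status_self, Config.apply_status_self, hstatus]) hmem
    exact ⟨⟨hc.1.congr hst hstatus (fun h => absurd h h1) hresp, this.1⟩, this.2⟩

end TM

/-! ### Progress: operations that run alone return -/

namespace TM

variable {n : ℕ} {X : Type u} {V : Type v} {M : TM.{u, v, w} n X V}

lemma pre_succ (s : ℕ → M.Event) (N : ℕ) : pre s (N + 1) = pre s N ++ [s N] := by
  simp [pre, List.range_succ]

/-- The event that process `p` issues next for its pending t-operation `o` of transaction `k`. -/
def nextEvent (p : Fin n) (k : TxnId) (o : Op X V) (c : M.Config) : M.Event :=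
  match M.next (c.st p) o with
  | .prim b f => .rmw p k b f (f.resp (c.mem b))
  | .ret r => .ret p k r

/-- A pending t-operation running alone returns, or else applies primitives forever. -/
lemma exists_ret_or_forever {c : M.Config} {p : Fin n} {k : TxnId} {o : Op X V}
    (hc : c.status p = .busy k o) :
    (∃ ρ r, (∀ e ∈ ρ, ∃ b f q, e = Event.rmw p k b f q) ∧ r.Matches o ∧
      c.Valid (ρ ++ [.ret p k r])) ∨
    ∃ s : ℕ → M.Event, (∀ N, c.Valid (pre s N)) ∧ ∀ i, ∃ b f q, s i = .rmw p k b f q := by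
  -- The iteration does not stop at a response, so `C` is meaningful only up to the first index at
  -- which `next` responds, which `Nat.find` selects below.
  let C : ℕ → M.Config := fun i => (fun c => c.apply (nextEvent p k o c))^[i] c
  have hC : ∀ i, C (i + 1) = (C i).apply (nextEvent p k o (C i)) := fun i =>
    Function.iterate_succ_apply' _ _ _
  let s : ℕ → M.Event := fun i => nextEvent p k o (C i)
  have main : ∀ N, (∀ j < N, ∃ b f, M.next ((C j).st p) o = .prim b f) →
      (C N).status p = .busy k o ∧ c.Valid (pre s N) ∧ c.run (pre s N) = C N ∧
        ∀ j < N, ∃ b f q, s j = .rmw p k b f q := by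
    intro N
    induction N with
    | zero => intro _; exact ⟨hc, trivial, rfl, by simp⟩
    | succ N ih =>
      intro h
      obtain ⟨h1, h2, h3, h4⟩ := ih fun j hj => h j (by omega)
      obtain ⟨b, f, hbf⟩ := h N (by omega)
      have hs : s N = .rmw p k b f (f.resp ((C N).mem b)) := by simp [s, nextEvent, hbf]
      refine ⟨?_, ?_, ?_, ?_⟩
      · rw [hC]
        change ((C N).apply (s N)).status p = _
        rw [hs]
        exact (Config.apply_status_self _ _).trans h1
      · rw [pre_succ, Config.valid_append, h3, hs]
        exact ⟨h2, ⟨⟨o, h1, hbf⟩, rfl⟩, trivial⟩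
      · rw [pre_succ, Config.run_append, h3, hC]
        rfl
      · intro j hj
        rcases Nat.lt_succ_iff_lt_or_eq.1 hj with hj | rfl
        · exact h4 j hj
        · exact ⟨_, _, _, hs⟩
  by_cases h : ∃ i r, M.next ((C i).st p) o = .ret r
  · classical
    left
    obtain ⟨r, hr⟩ := Nat.find_spec h
    have hmin : ∀ j < Nat.find h, ∃ b f, M.next ((C j).st p) o = .prim b f := by
      intro j hj
      have := Nat.find_min h hj
      cases hn : M.next ((C j).st p) o with
      | prim b f => exact ⟨b, f, rfl⟩
      | ret r => exact absurd ⟨r, hn⟩ this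
    obtain ⟨h1, h2, h3, h4⟩ := main _ hmin
    refine ⟨pre s (Nat.find h), r, ?_, M.next_matches _ _ _ hr, ?_⟩
    · intro e he
      obtain ⟨j, hj, rfl⟩ := List.mem_map.1 he
      exact h4 j (List.mem_range.1 hj)
    · rw [Config.valid_append, h3]
      exact ⟨h2, ⟨o, h1, hr⟩, trivial⟩
  · right
    have hall : ∀ j, ∃ b f, M.next ((C j).st p) o = .prim b f := by
      intro j
      cases hn : M.next ((C j).st p) o with
      | prim b f => exact ⟨b, f, rfl⟩
      | ret r => exact absurd ⟨j, r, hn⟩ h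
    exact ⟨s, fun N => (main N fun j _ => hall j).2.1,
      fun i => (main (i + 1) fun j _ => hall j).2.2.2 i (by omega)⟩

/-- The process may invoke a t-operation of the transaction. -/
def Ready (c : M.Config) (p : Fin n) (k : TxnId) : Prop :=
  (c.status p = .free ∧ k ∉ c.used) ∨ c.status p = .active k

lemma IsOpFragment.status {p : Fin n} {k : TxnId} {o : Op X V} {r : Ret V} {α : List M.Event}
    (h : IsOpFragment p k o r α) (hr : ¬ r.IsFinal) (c : M.Config) :
    (c.run α).status p = .active k := by
  obtain ⟨ρ, -, rfl⟩ := h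
  rw [Config.run_cons, Config.run_append, Config.run_cons, Config.run_nil]
  refine (Config.apply_status_self _ (.ret p k r)).trans ?_
  simp [Event.statusUpd, hr]

lemma history_rmws {p : Fin n} {k : TxnId} {ρ : List M.Event}
    (h : ∀ e ∈ ρ, ∃ b f q, e = Event.rmw p k b f q) : history ρ = [] := by
  refine List.filterMap_eq_nil_iff.2 fun e he => ?_
  obtain ⟨b, f, q, rfl⟩ := h e he
  rfl

lemma IsOpFragment.history_eq {p : Fin n} {k : TxnId} {o : Op X V} {r : Ret V}
    {α : List M.Event} (h : IsOpFragment p k o r α) :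
    history α = [.inv k o, .ret k r] := by
  obtain ⟨ρ, hρ, rfl⟩ := h
  simp [history_rmws hρ]

lemma IsOpFragment.solo {p : Fin n} {k : TxnId} {o : Op X V} {r : Ret V}
    {α : List M.Event} (h : IsOpFragment p k o r α) : Solo p k α := by
  obtain ⟨ρ, hρ, rfl⟩ := h
  intro e he
  simp only [List.mem_cons, List.mem_append, List.not_mem_nil, or_false] at he
  rcases he with rfl | he | rfl
  · exact ⟨rfl, rfl⟩
  · obtain ⟨b, f, q, rfl⟩ := hρ e he
    exact ⟨rfl, rfl⟩
  · exact ⟨rfl, rfl⟩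

lemma aborted_of_history_eq {E : List M.Event} {H : History X V} {k : TxnId}
    (h : history E = H ++ [.ret k .abort]) : (history E).Aborted k := by
  rw [h, History.Aborted, History.proj, List.filter_append]
  simp [HEvent.txn]

/-- If a t-operation invoked after `E` and running alone can neither run forever nor abort, then it
returns. -/
lemma exists_opFragment {E : List M.Event} {p : Fin n} {k : TxnId} {o : Op X V}
    (hE : M.IsExec E) (hr : Ready (M.initConfig.run E) p k)
    (hprog : ∀ s : ℕ → M.Event, M.IsInfExec s → pre s E.length = E → s E.length = .inv p k o →
      (∀ i, E.length < i → ∃ b f q, s i = .rmw p k b f q) → OpsReturn s k)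
    (habort : ∀ α, IsOpFragment p k o .abort α → ¬ M.IsExec (E ++ α)) :
    ∃ r α, r.Matches o ∧ r ≠ .abort ∧ IsOpFragment p k o r α ∧ M.IsExec (E ++ α) := by
  have hbusy : ((M.initConfig.run E).apply (.inv p k o)).status p = .busy k o :=
    Config.apply_status_self _ (.inv p k o)
  rw [isExec_iff] at hE
  rcases exists_ret_or_forever hbusy with ⟨ρ, r, hρ, hm, hv⟩ | ⟨s, hv, hs⟩
  · have hf : IsOpFragment p k o r (Event.inv p k o :: (ρ ++ [.ret p k r])) := ⟨ρ, hρ, rfl⟩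
    have hex : M.IsExec (E ++ Event.inv p k o :: (ρ ++ [.ret p k r])) := by
      rw [isExec_iff, Config.valid_append, Config.valid_cons]
      exact ⟨hE, hr, hv⟩
    exact ⟨r, _, hm, by rintro rfl; exact habort _ hf hex, hf, hex⟩
  · exfalso
    -- The infinite execution that progress excludes: `E`, then the invocation, then the endless
    -- primitives, so that the invocation is never answered.
    let t : ℕ → M.Event := fun i =>
      if h : i < E.length then E[i] else if i = E.length then .inv p k o
        else s (i - (E.length + 1))
    have ht1 : pre t E.length = E := by
      refine List.ext_getElem (by simp [pre]) fun i h1 h2 => ?_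
      simp [pre, t, h2]
    have ht2 : t E.length = .inv p k o := by simp [t]
    have ht3 : ∀ i, t (E.length + 1 + i) = s i := by
      intro i
      have h1 : ¬ E.length + 1 + i < E.length := by omega
      have h2 : E.length + 1 + i ≠ E.length := by omega
      simp only [t, h1, h2, dite_false, if_false]
      congr 1
      omega
    have ht4 : ∀ N, pre t (E.length + 1 + N) = E ++ .inv p k o :: pre s N := by
      intro N
      induction N with
      | zero => rw [Nat.add_zero, pre_succ, ht1, ht2]; rfl
      | succ N ih =>
        rw [← Nat.add_assoc, pre_succ, ih, ht3, pre_succ]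
        simp
    have ht5 : ∀ i, E.length < i → ∃ b f q, t i = .rmw p k b f q := by
      intro i hi
      obtain ⟨j, rfl⟩ := Nat.exists_eq_add_of_le (Nat.succ_le_of_lt hi)
      rw [Nat.succ_eq_add_one, ht3]
      exact hs j
    have hinf : M.IsInfExec t := by
      intro N
      have h1 : M.initConfig.Valid (pre t (E.length + 1 + N)) := by
        rw [ht4, Config.valid_append, Config.valid_cons]
        exact ⟨hE, hr, hv N⟩
      have h2 : pre t N <+: pre t (E.length + 1 + N) := by
        simp only [pre]
        rw [Nat.add_comm, List.range_add, List.map_append]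
        exact List.prefix_append _ _
      obtain ⟨F, hF⟩ := h2
      rw [← hF, Config.valid_append] at h1
      exact isExec_iff.2 h1.1
    have hop := hprog t hinf ht1 ht2 ht5
    have hinfset : {i | (t i).txn = k}.Infinite := by
      refine Set.infinite_of_not_bddAbove ?_
      rintro ⟨N, hN⟩
      obtain ⟨b, f, q, h⟩ := ht5 (E.length + 1 + N) (by omega)
      have := hN (show (t (E.length + 1 + N)).txn = k by rw [h]; rfl)
      omega
    obtain ⟨j, hj, -, h⟩ := hop hinfset E.length (by rw [ht2]; rfl) (by rw [ht2]; trivial)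
    obtain ⟨b, f, q, hq⟩ := ht5 j hj
    rw [hq] at h
    exact h

/-- Wait-freedom demands that the transaction be read-only along the whole infinite execution. This
persists because only primitives follow the last invocation. -/
lemma pre_history_readOnly {E : List M.Event} {p : Fin n} {k : TxnId} {o : Op X V}
    {s : ℕ → M.Event} (hro : (history E).ReadOnly k) (ho : ∀ x a, o ≠ .write x a)
    (h1 : pre s E.length = E) (h2 : s E.length = .inv p k o)
    (h3 : ∀ i, E.length < i → ∃ b f q, s i = .rmw p k b f q) (N : ℕ) :
    (history (pre s N)).ReadOnly k := by
  refine Set.eq_empty_iff_forall_notMem.2 ?_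
  rintro x ⟨a, hx⟩
  obtain ⟨e, he, hex⟩ := List.mem_filterMap.1 hx
  obtain ⟨i, -, rfl⟩ := List.mem_map.1 he
  rcases lt_trichotomy i E.length with hi | rfl | hi
  · refine Set.eq_empty_iff_forall_notMem.1 hro x ⟨a, ?_⟩
    refine List.mem_filterMap.2 ⟨s i, ?_, hex⟩
    rw [← h1]
    exact List.mem_map.2 ⟨i, List.mem_range.2 hi, rfl⟩
  · rw [h2] at hex
    simp only [Event.toHEvent, Option.some.injEq, HEvent.inv.injEq, true_and] at hex
    exact ho x a hex
  · obtain ⟨b, f, q, hq⟩ := h3 i hi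
    rw [hq] at hex
    simp [Event.toHEvent] at hex

lemma readOnly_append {E E' : List M.Event} {k : TxnId} (h : (history E).ReadOnly k)
    (h' : (history E').ReadOnly k) : (history (E ++ E')).ReadOnly k := by
  simp only [History.ReadOnly, History.wset, Set.eq_empty_iff_forall_notMem,
    Set.mem_ofPred_eq, not_exists, history_append, List.mem_append, not_or] at *
  exact fun x a => ⟨h x a, h' x a⟩

lemma IsOpFragment.readOnly {p : Fin n} {k : TxnId} {o : Op X V} {r : Ret V}
    {α : List M.Event} (h : IsOpFragment p k o r α) (ho : ∀ x a, o ≠ .write x a) (l : TxnId) :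
    (history α).ReadOnly l := by
  refine Set.eq_empty_iff_forall_notMem.2 ?_
  rintro x ⟨a, hx⟩
  rw [h.history_eq] at hx
  simp only [List.mem_cons, HEvent.inv.injEq, List.not_mem_nil, or_false, reduceCtorEq] at hx
  exact ho x a hx.2.symm

/-- T-operations of read-only transactions that run alone return. -/
lemma WaitFreeReadOnly.exists_opFragment (hM : M.WaitFreeReadOnly) {E : List M.Event} {p : Fin n}
    {k : TxnId} {o : Op X V} (hE : M.IsExec E) (hr : Ready (M.initConfig.run E) p k)
    (hro : (history E).ReadOnly k) (ho : ∀ x a, o ≠ .write x a) :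
    ∃ r α, r.Matches o ∧ r ≠ .abort ∧ IsOpFragment p k o r α ∧ M.IsExec (E ++ α) := by
  refine TM.exists_opFragment hE hr (fun s hs h1 h2 h3 =>
    hM.2 s hs k (pre_history_readOnly hro ho h1 h2 h3)) fun α hα hex => ?_
  refine hM.1 _ hex k (readOnly_append hro (hα.readOnly ho k)) ?_
  exact aborted_of_history_eq (H := history E ++ [.inv k o]) (by simp [hα.history_eq])

/-- T-operations of a transaction that runs alone from the initial configuration return. -/
lemma SequentialProgress.exists_opFragment (hM : M.SequentialProgress) {E : List M.Event}
    {p : Fin n} {k : TxnId} {o : Op X V} (hE : M.IsExec E)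
    (hr : Ready (M.initConfig.run E) p k) (hs : Solo p k E) :
    ∃ r α, r.Matches o ∧ r ≠ .abort ∧ IsOpFragment p k o r α ∧ M.IsExec (E ++ α) := by
  have hq : TQuiescent ([] : List M.Event) := by
    rintro l ⟨e, he, -⟩
    simp at he
  refine TM.exists_opFragment hE hr (fun s hinf h1 h2 h3 => ?_) fun α hα hex => ?_
  · refine hM.2 s hinf 0 hq k fun i _ => ?_
    rcases lt_trichotomy i E.length with hi | rfl | hi
    · refine (hs (s i) ?_).2
      rw [← h1]
      exact List.mem_map.2 ⟨i, List.mem_range.2 hi, rfl⟩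
    · rw [h2]; rfl
    · obtain ⟨b, f, q, hq⟩ := h3 i hi
      rw [hq]; rfl
  · refine hM.1 [] (E ++ α) hex hq k (fun e he => (hs.append hα.solo e he).2) ?_ ?_
    · obtain ⟨ρ, -, rfl⟩ := hα
      simp
    · exact aborted_of_history_eq (H := history E ++ [.inv k o]) (by simp [hα.history_eq])

lemma ready_initConfig (p : Fin n) (k : TxnId) : Ready M.initConfig p k :=
  Or.inl ⟨rfl, id⟩

/-- From the initial configuration, a transaction can write a value to a t-object and commit. -/
lemma SequentialProgress.exists_writer (hM : M.SequentialProgress) (p : Fin n) (k : TxnId)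
    (x : X) (a : V) :
    ∃ E : List M.Event, M.IsExec E ∧ Solo p k E ∧
      history E = [.inv k (.write x a), .ret k .ok, .inv k .tryC, .ret k .commit] := by
  obtain ⟨r, α, hm, hne, hα, hex⟩ := hM.exists_opFragment (E := []) (p := p) (k := k)
    (o := .write x a) (isExec_iff.2 trivial) (ready_initConfig p k) (by simp [Solo])
  obtain rfl : r = .ok := by cases r <;> simp_all [Ret.Matches]
  obtain ⟨r, γ, hm', hne', hγ, hex'⟩ := hM.exists_opFragment (p := p) (k := k) (o := .tryC) hex
    (Or.inr (hα.status id _)) hα.solo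
  obtain rfl : r = .commit := by cases r <;> simp_all [Ret.Matches]
  exact ⟨_, hex', hα.solo.append hγ.solo, by simp [hα.history_eq, hγ.history_eq]⟩

lemma WaitFreeReadOnly.exists_read (hM : M.WaitFreeReadOnly) {E : List M.Event} {p : Fin n}
    {k : TxnId} (hE : M.IsExec E) (hr : Ready (M.initConfig.run E) p k)
    (hro : (history E).ReadOnly k) (x : X) :
    ∃ a α, IsOpFragment p k (.read x) (.val a) α ∧ M.IsExec (E ++ α) := by
  obtain ⟨r, α, hm, hne, hα, hex⟩ := hM.exists_opFragment (o := .read x) hE hr hro (by simp)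
  cases r with
  | val a => exact ⟨a, α, hα, hex⟩
  | _ => simp_all [Ret.Matches]

lemma WaitFreeReadOnly.exists_commit (hM : M.WaitFreeReadOnly) {E : List M.Event} {p : Fin n}
    {k : TxnId} (hE : M.IsExec E) (hr : Ready (M.initConfig.run E) p k)
    (hro : (history E).ReadOnly k) :
    ∃ γ, IsOpFragment p k .tryC .commit γ ∧ M.IsExec (E ++ γ) := by
  obtain ⟨r, α, hm, hne, hα, hex⟩ := hM.exists_opFragment (o := .tryC) hE hr hro (by simp)
  cases r with
  | commit => exact ⟨α, hα, hex⟩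
  | _ => simp_all [Ret.Matches]

/-- A transaction running alone from the initial configuration can read any sequence of
t-objects. -/
lemma WaitFreeReadOnly.exists_reads (hM : M.WaitFreeReadOnly) (p : Fin n) (k : TxnId) {m : ℕ}
    (x : Fin m → X) :
    ∃ α : Fin m → List M.Event, (∀ i, ∃ a, IsOpFragment p k (.read (x i)) (.val a) (α i)) ∧
      M.IsExec (List.ofFn α).flatten ∧ Ready (M.initConfig.run (List.ofFn α).flatten) p k ∧
      (history (List.ofFn α).flatten).ReadOnly k := by
  induction m with
  | zero =>
    refine ⟨fun _ => [], fun i => i.elim0, isExec_iff.2 ?_, ?_, ?_⟩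
    · simp
    · simpa using ready_initConfig p k
    · simp [History.ReadOnly, History.wset]
  | succ m ih =>
    obtain ⟨α, h1, h2, h3, h4⟩ := ih fun i => x i.castSucc
    obtain ⟨a, β, h5, h6⟩ := hM.exists_read h2 h3 h4 (x (Fin.last m))
    have hfl : (List.ofFn (Fin.snoc (α := fun _ => List M.Event) α β)).flatten =
        (List.ofFn α).flatten ++ β := by
      rw [List.ofFn_succ']
      simp
    refine ⟨Fin.snoc (α := fun _ => List M.Event) α β, fun i => ?_, ?_, ?_, ?_⟩
    · refine Fin.lastCases ?_ (fun j => ?_) i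
      · simpa using ⟨a, h5⟩
      · simpa using h1 j
    · rwa [hfl]
    · rw [hfl, Config.run_append]
      exact Or.inr (h5.status id _)
    · rw [hfl]
      exact readOnly_append h4 (h5.readOnly (by simp) k)

end TM

/-! ### Serializations: what a read must return -/

namespace History

variable {X : Type u} {V : Type v}

lemma mem_proj {H : History X V} {k : TxnId} {e : HEvent X V} :
    e ∈ H.proj k ↔ e ∈ H ∧ e.txn = k := by
  simp [proj]

lemma mem_iff_of_proj_eq {S H : History X V} (h : ∀ k, S.proj k = H.proj k) (e : HEvent X V) :
    e ∈ S ↔ e ∈ H := by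
  have := congrArg (e ∈ ·) (h e.txn)
  simpa [mem_proj] using this

lemma proj_append (H H' : History X V) (k : TxnId) :
    (H ++ H').proj k = H.proj k ++ H'.proj k := List.filter_append ..

lemma proj_eq_self {H : History X V} {k : TxnId} (h : ∀ e ∈ H, e.txn = k) : H.proj k = H :=
  List.filter_eq_self.2 (by simpa using h)

lemma proj_eq_nil {H : History X V} {k : TxnId} (h : ∀ e ∈ H, e.txn ≠ k) : H.proj k = [] :=
  List.filter_eq_nil_iff.2 (by simpa using h)

lemma cseq_proj (H : History X V) {k : TxnId} (h : H.Committed k) : H.cseq.proj k = H.proj k := by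
  classical
  simp only [cseq, proj, List.filter_filter]
  refine List.filter_congr fun e _ => ?_
  by_cases he : e.txn = k
  · simp [he, h]
  · simp [he]

/-- A strictly serializable history of committed transactions is equivalent to a legal history which
respects the real-time order. -/
lemma StrictlySerializable.exists_serialization {init : X → V} {H : History X V}
    (h : H.StrictlySerializable init) (hc : ∀ k ∈ H.txns, H.Committed k) :
    ∃ S : History X V, S.Legal init ∧ (∀ k m, H.Precedes k m → S.Precedes k m) ∧
      ∀ k, S.proj k = H.proj k := by
  obtain ⟨S, H', -, -, hlegal, hrt, ⟨-, hcomp⟩, hS⟩ := h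
  -- When all transactions are committed, a completion adds no events and the reduction to committed
  -- transactions removes none.
  have hproj : ∀ k, S.proj k = H.proj k := by
    intro k
    have hk := hcomp k
    by_cases hkt : k ∈ H.txns
    · have hkc : (H.proj k).getLast? = some (.ret k .commit) := hc k hkt
      rw [hkc] at hk
      have hk' := hk.1 trivial
      rw [hS k, cseq_proj, hk']
      rw [Committed, hk', hkc]
    · have hnil : H.proj k = [] :=
        proj_eq_nil fun e he hek => hkt ⟨e, he, hek⟩
      rw [hnil] at hk
      have hk' : H'.proj k = [] := hk
      rw [hS k, hnil]
      refine proj_eq_nil fun e he hek => ?_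
      have : e ∈ H'.proj k := mem_proj.2 ⟨List.mem_of_mem_filter he, hek⟩
      rw [hk'] at this
      simp at this
  have htx : ∀ k, k ∈ H.txns → k ∈ S.txns := by
    rintro k ⟨e, he, hek⟩
    exact ⟨e, (mem_iff_of_proj_eq hproj e).2 he, hek⟩
  exact ⟨S, hlegal, fun k m hkm => hrt k (htx k hkm.1) m (htx m hkm.2.1) hkm, hproj⟩

lemma mem_writesTo {H : History X V} {P : TxnId → Prop} {x : X} {a : V} :
    a ∈ H.writesTo P x ↔ ∃ l, P l ∧ .inv l (.write x a) ∈ H := by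
  classical
  simp only [writesTo, List.mem_filterMap]
  constructor
  · rintro ⟨e, he, h⟩
    split at h
    · rename_i l y b
      split_ifs at h with hl
      obtain ⟨hl, rfl⟩ := hl
      obtain rfl := Option.some.inj h
      exact ⟨l, hl, he⟩
    · simp at h
  · rintro ⟨l, hl, h⟩
    exact ⟨_, h, by simp [hl]⟩

/-- A t-read in a legal history returns the latest written value. -/
lemma Legal.read_eq {init : X → V} {S : History X V} (hS : S.Legal init) {k : TxnId} {x : X}
    {a : V} (h : [.inv k (.read x), .ret k (.val a)] <:+: S.proj k) :
    ∃ S₁ S₂, S = S₁ ++ .ret k (.val a) :: S₂ ∧ a = latestWritten init S S₁ k x := by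
  obtain ⟨L₁, L₂, hL⟩ := h
  have hL' : S.proj k = (L₁ ++ [.inv k (.read x)]) ++ .ret k (.val a) :: L₂ := by
    rw [← hL]; simp
  obtain ⟨S₁, S₂', hS', h1, h2⟩ := List.filter_eq_append_iff.1 hL'
  obtain ⟨T, S₂, rfl, h3, h4, h5⟩ := List.filter_eq_cons_iff.1 h2
  refine ⟨S₁ ++ T, S₂, by rw [hS', List.append_assoc],
    hS _ S₂ k x a (by rw [hS', List.append_assoc]) ?_⟩
  rw [proj_append, proj_eq_nil (H := T) (by simpa using h3), List.append_nil]
  change (List.filter _ S₁).getLast? = _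
  rw [h1]
  simp

lemma latestWritten_of_no_own_write {init : X → V} {S S₁ : History X V} {k : TxnId} {x : X}
    (h : ∀ a, .inv k (.write x a) ∉ S₁) : latestWritten init S S₁ k x =
      ((S₁.writesTo (fun l => S.Committed l ∧ S.Precedes l k) x).getLast?).getD (init x) := by
  have : S₁.writesTo (fun l => l = k) x = [] := by
    refine List.eq_nil_iff_forall_not_mem.2 fun a ha => ?_
    obtain ⟨l, rfl, hl⟩ := mem_writesTo.1 ha
    exact h a hl
  simp [latestWritten, this]

lemma Precedes.mem_of_mem {S S₁ S₂ : History X V} {l k : TxnId} {e g : HEvent X V}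
    (h : S.Precedes l k) (hS : S = S₁ ++ g :: S₂) (hg : g.txn = k) (he : e ∈ S) (hel : e.txn = l)
    (hlk : l ≠ k) : e ∈ S₁ := by
  have hp := h.2.2.2
  rw [hS] at he hp
  rcases List.mem_append.1 he with he | he
  · exact he
  rcases List.mem_cons.1 he with rfl | he
  · exact absurd (hel.symm.trans hg) hlk
  · exact absurd ⟨hg, hel⟩ (List.rel_of_pairwise_cons (List.pairwise_append.1 hp).2.1 he)

/-- Any event of `j` splits the history: every event of `i` lies before it, and no event of `k`
does. The assumption `i ≠ j` keeps the splitting event itself from belonging to `i`. -/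
lemma Precedes.trans {S : History X V} {i j k : TxnId} (h : S.Precedes i j)
    (h' : S.Precedes j k) (hij : i ≠ j) : S.Precedes i k := by
  refine ⟨h.1, h'.2.1, h.2.2.1, ?_⟩
  obtain ⟨e, he, rfl⟩ := h.2.1
  obtain ⟨S₁, S₂, hS⟩ := List.append_of_mem he
  have h1 : ∀ g ∈ S, g.txn = i → g ∈ S₁ := fun g hg hgi =>
    h.mem_of_mem hS rfl hg hgi hij
  have h2 : ∀ g ∈ S₁, g.txn ≠ k := by
    intro g hg hgk
    have hp := h'.2.2.2
    rw [hS] at hp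
    exact (List.pairwise_append.1 hp).2.2 g hg e (by simp) ⟨hgk, rfl⟩
  have h3 : ∀ g ∈ e :: S₂, g.txn ≠ i := by
    intro g hg hgi
    have hp := h.2.2.2
    rw [hS] at hp
    rcases List.mem_cons.1 hg with rfl | hg
    · exact hij hgi.symm
    · exact List.rel_of_pairwise_cons (List.pairwise_append.1 hp).2.1 hg ⟨rfl, hgi⟩
  rw [hS]
  refine List.pairwise_append.2 ⟨?_, ?_, ?_⟩
  · exact List.pairwise_of_forall_mem_list fun a ha b _ hab => h2 a ha hab.1
  · exact List.pairwise_of_forall_mem_list fun a _ b hb hab => h3 b hb hab.2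
  · exact fun a ha b _ hab => h2 a ha hab.1

/-- If the only write to `x` is by a transaction that precedes `k`, then `k` reads the value
written. -/
lemma Legal.eq_of_precedes {init : X → V} {S : History X V} (hS : S.Legal init) {k l : TxnId}
    {x : X} {a c : V} (hread : [.inv k (.read x), .ret k (.val a)] <:+: S.proj k)
    (hl : .inv l (.write x c) ∈ S) (hlc : S.Committed l) (hlk : S.Precedes l k) (hne : l ≠ k)
    (honly : ∀ j b, .inv j (.write x b) ∈ S → j = l ∧ b = c) : a = c := by
  obtain ⟨S₁, S₂, hS₁, rfl⟩ := hS.read_eq hread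
  have hsub : ∀ e ∈ S₁, e ∈ S := fun e he => by rw [hS₁]; exact List.mem_append_left _ he
  rw [latestWritten_of_no_own_write fun b hb => hne (honly k b (hsub _ hb)).1.symm]
  have hmem : c ∈ S₁.writesTo (fun l => S.Committed l ∧ S.Precedes l k) x :=
    mem_writesTo.2 ⟨l, ⟨hlc, hlk⟩, hlk.mem_of_mem hS₁ rfl hl rfl hne⟩
  have hne' := List.ne_nil_of_mem hmem
  -- Which write comes last is irrelevant: the list is nonempty and every write to `x` writes `c`.
  rw [List.getLast?_eq_some_getLast hne', Option.getD_some]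
  obtain ⟨j, -, hj⟩ := mem_writesTo.1 (List.getLast_mem hne')
  exact (honly j _ (hsub _ hj)).2

/-- If a transaction reads a value other than the initial one, then a preceding transaction has
written to the t-object. -/
lemma Legal.exists_precedes {init : X → V} {S : History X V} (hS : S.Legal init) {k : TxnId}
    {x : X} {a : V} (hread : [.inv k (.read x), .ret k (.val a)] <:+: S.proj k)
    (hown : ∀ b, .inv k (.write x b) ∉ S) (ha : a ≠ init x) :
    ∃ l b, .inv l (.write x b) ∈ S ∧ S.Precedes l k := by
  obtain ⟨S₁, S₂, hS₁, rfl⟩ := hS.read_eq hread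
  have hsub : ∀ e ∈ S₁, e ∈ S := fun e he => by rw [hS₁]; exact List.mem_append_left _ he
  rw [latestWritten_of_no_own_write fun b hb => hown b (hsub _ hb)] at ha
  cases hw : S₁.writesTo (fun l => S.Committed l ∧ S.Precedes l k) x with
  | nil => simp [hw] at ha
  | cons b L =>
    obtain ⟨l, hl, hb⟩ := mem_writesTo.1 (show b ∈ S₁.writesTo _ x by rw [hw]; simp)
    exact ⟨l, b, hsub _ hb, hl.2⟩

section Serializable

variable {init : X → V} {H : History X V} {k l m : TxnId} {x y : X} {a b c d : V}

lemma committed_congr {S : History X V} (h : ∀ k, S.proj k = H.proj k) :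
    S.Committed k ↔ H.Committed k := by
  rw [Committed, Committed, h]

/-- A t-read returns the value of the unique write to the t-object if the writer precedes. -/
lemma StrictlySerializable.read_eq_of_precedes (h : H.StrictlySerializable init)
    (hc : ∀ k ∈ H.txns, H.Committed k)
    (hread : [.inv k (.read x), .ret k (.val a)] <:+: H.proj k)
    (hl : .inv l (.write x c) ∈ H) (hlk : H.Precedes l k) (hne : l ≠ k)
    (honly : ∀ j b, .inv j (.write x b) ∈ H → j = l ∧ b = c) : a = c := by
  obtain ⟨S, hS, hrt, hproj⟩ := h.exists_serialization hc
  have hmem := mem_iff_of_proj_eq hproj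
  refine hS.eq_of_precedes (by rwa [hproj]) ((hmem _).2 hl)
    ((committed_congr hproj).2 (hc l hlk.1)) (hrt _ _ hlk) hne fun j b hj => ?_
  exact honly j b ((hmem _).1 hj)

/-- If `k` reads the value that `m` has written to `y`, and the only writer `l` of `x` precedes `m`,
then `k` reads the value that `l` has written to `x`. -/
lemma StrictlySerializable.read_eq_of_reads_later (h : H.StrictlySerializable init)
    (hc : ∀ k ∈ H.txns, H.Committed k)
    (hx : [.inv k (.read x), .ret k (.val a)] <:+: H.proj k)
    (hy : [.inv k (.read y), .ret k (.val b)] <:+: H.proj k)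
    (hb : b ≠ init y) (hl : .inv l (.write x c) ∈ H) (hlm : H.Precedes l m)
    (hne : l ≠ k) (hne' : m ≠ k) (hne'' : l ≠ m)
    (honly : ∀ j b, .inv j (.write x b) ∈ H → j = l ∧ b = c)
    (honly' : ∀ j b, .inv j (.write y b) ∈ H → j = m) : a = c := by
  obtain ⟨S, hS, hrt, hproj⟩ := h.exists_serialization hc
  have hmem := mem_iff_of_proj_eq hproj
  obtain ⟨j, b', hj, hjk⟩ := hS.exists_precedes (by rwa [hproj])
    (fun b hb => hne' (honly' k b ((hmem _).1 hb)).symm) hb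
  obtain rfl := honly' j b' ((hmem _).1 hj)
  refine hS.eq_of_precedes (by rwa [hproj]) ((hmem _).2 hl)
    ((committed_congr hproj).2 (hc l hlm.1)) ((hrt _ _ hlm).trans hjk hne'') hne
    fun j b hj => ?_
  exact honly j b ((hmem _).1 hj)

end Serializable

/-- A transaction which is committed in a prefix and has no events later precedes every transaction
without events in the prefix. -/
lemma precedes_append {A B : History X V} {l k : TxnId}
    (hl : l ∈ A.txns) (hk : k ∈ B.txns) (hA : ∀ e ∈ A, e.txn ≠ k) (hB : ∀ e ∈ B, e.txn ≠ l)
    (hc : A.Committed l) : (A ++ B).Precedes l k := by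
  obtain ⟨e, he, hel⟩ := hl
  obtain ⟨g, hg, hgk⟩ := hk
  refine ⟨⟨e, by simp [he], hel⟩, ⟨g, by simp [hg], hgk⟩, Or.inl ?_, ?_⟩
  · rw [Committed, proj_append, proj_eq_nil (H := B) hB, List.append_nil]
    exact hc
  · refine List.pairwise_append.2 ⟨?_, ?_, ?_⟩
    · exact List.pairwise_of_forall_mem_list fun a ha b _ hab => hA a ha hab.1
    · exact List.pairwise_of_forall_mem_list fun a _ b hb hab => hB b hb hab.2
    · exact fun a ha b _ hab => hA a ha hab.1

end History

/-! ### One reader, two orders of the writers -/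

namespace History

variable {X : Type u} {V : Type v}

/-- The history of a transaction that writes `a` to `x` and commits. -/
abbrev writer (k : TxnId) (x : X) (a : V) : History X V :=
  [.inv k (.write x a), .ret k .ok, .inv k .tryC, .ret k .commit]

/-- The events of three committed transactions: a reader, and the writers of `y` and `x`. -/
lemma facts_of_proj {H P : History X V} {k k₁ k₂ : TxnId} {x y : X} {c₁ c₂ : V}
    (hP : H.proj k = P) (h₁ : H.proj k₁ = writer k₁ y c₁) (h₂ : H.proj k₂ = writer k₂ x c₂)
    (ht : ∀ e ∈ H, e.txn = k ∨ e.txn = k₁ ∨ e.txn = k₂)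
    (hc : P.getLast? = some (.ret k .commit)) (hw : ∀ z c, .inv k (.write z c) ∉ P) :
    (∀ j ∈ H.txns, H.Committed j) ∧ .inv k₁ (.write y c₁) ∈ H ∧ .inv k₂ (.write x c₂) ∈ H ∧
      ∀ j z c, .inv j (.write z c) ∈ H → j = k₁ ∧ z = y ∧ c = c₁ ∨ j = k₂ ∧ z = x ∧ c = c₂ := by
  refine ⟨?_, ?_, ?_, ?_⟩
  · rintro j ⟨e, he, rfl⟩
    rcases ht e he with h | h | h <;> rw [h, Committed]
    · rw [hP, hc]
    · rw [h₁]; simp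
    · rw [h₂]; simp
  · exact (mem_proj (k := k₁).1 (by rw [h₁]; simp)).1
  · exact (mem_proj (k := k₂).1 (by rw [h₂]; simp)).1
  · intro j z c hj
    have hj' : .inv j (.write z c) ∈ H.proj j := mem_proj.2 ⟨hj, rfl⟩
    rcases ht _ hj with h | h | h <;> simp only [HEvent.txn] at h <;> subst h
    · rw [hP] at hj'
      exact absurd hj' (hw z c)
    · rw [h₁] at hj'
      exact Or.inl (by simpa using hj')
    · rw [h₂] at hj'
      exact Or.inr (by simpa using hj')

/-- A reader which cannot tell whether the writer of `y` runs first or after the writer of `x`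
returns the new value of `x`. -/
lemma read_eq_of_two_orders {init : X → V} {A B : History X V} {k k₁ k₂ : TxnId} {x y : X}
    {a b c₁ c₂ : V} (hk₁ : k ≠ k₁) (hk₂ : k ≠ k₂) (hk : k₁ ≠ k₂) (hxy : x ≠ y)
    (hA : ∀ e ∈ A, e.txn = k) (hB : ∀ e ∈ B, e.txn = k)
    (hc : (A ++ B).getLast? = some (.ret k .commit)) (hw : ∀ z c, .inv k (.write z c) ∉ A ++ B)
    (hx : [.inv k (.read x), .ret k (.val a)] <:+: A ++ B)
    (hy : [.inv k (.read y), .ret k (.val b)] <:+: A ++ B) (hc₁ : c₁ ≠ init y)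
    (hF : StrictlySerializable init (A ++ (writer k₂ x c₂ ++ (writer k₁ y c₁ ++ B))))
    (hG : StrictlySerializable init (writer k₁ y c₁ ++ (A ++ (writer k₂ x c₂ ++ B)))) :
    a = c₂ := by
  have hA' : ∀ j, k ≠ j → ∀ e ∈ A, e.txn ≠ j := fun j hj e he => by rw [hA e he]; exact hj
  have hB' : ∀ j, k ≠ j → ∀ e ∈ B, e.txn ≠ j := fun j hj e he => by rw [hB e he]; exact hj
  have hW : ∀ j (z : X) (c : V), ∀ e ∈ writer j z c, e.txn = j := by
    intro j z c e he
    simp only [List.mem_cons, List.not_mem_nil, or_false] at he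
    rcases he with rfl | rfl | rfl | rfl <;> rfl
  have hW' : ∀ i j, i ≠ j → ∀ (z : X) (c : V), ∀ e ∈ writer i z c, e.txn ≠ j :=
    fun i j hij z c e he => by rw [hW i z c e he]; exact hij
  have pA := proj_eq_self hA
  have pB := proj_eq_self hB
  have pA' : ∀ j, k ≠ j → A.proj j = [] := fun j hj => proj_eq_nil (hA' j hj)
  have pB' : ∀ j, k ≠ j → B.proj j = [] := fun j hj => proj_eq_nil (hB' j hj)
  have pW : ∀ j (z : X) (c : V), proj (writer j z c) j = writer j z c :=
    fun j z c => proj_eq_self (hW j z c)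
  have pW' : ∀ i j, i ≠ j → ∀ (z : X) (c : V), proj (writer i z c) j = [] :=
    fun i j hij z c => proj_eq_nil (hW' i j hij z c)
  have hWt : ∀ j (z : X) (c : V), j ∈ txns (writer j z c) := fun j z c =>
    ⟨.inv j .tryC, by simp, rfl⟩
  have hWc : ∀ j (z : X) (c : V), Committed (writer j z c) j := fun j z c => by
    rw [Committed, pW]; simp
  have hkmem : .inv k (.read x) ∈ A ++ B := hx.subset (by simp)
  -- In the second history the writer of `y` is complete before the reader starts. The value `b`
  -- found there is shared with the first history.
  have hb : b = c₁ := by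
    have hPG : (writer k₁ y c₁ ++ (A ++ (writer k₂ x c₂ ++ B))).proj k = A ++ B := by
      rw [proj_append, proj_append, proj_append, pA, pB, pW' _ _ hk₁.symm, pW' _ _ hk₂.symm]
      rfl
    obtain ⟨h1, h2, -, h4⟩ := facts_of_proj (k₁ := k₁) (k₂ := k₂) (x := x) (y := y) (c₁ := c₁)
      (c₂ := c₂) hPG
      (by rw [proj_append, proj_append, proj_append, pA' _ hk₁, pB' _ hk₁, pW, pW' _ _ hk.symm]; rfl)
      (by rw [proj_append, proj_append, proj_append, pA' _ hk₂, pB' _ hk₂, pW, pW' _ _ hk]; rfl)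
      (fun e he => by
        rcases List.mem_append.1 he with he | he
        · exact Or.inr (Or.inl (hW _ _ _ e he))
        rcases List.mem_append.1 he with he | he
        · exact Or.inl (hA e he)
        rcases List.mem_append.1 he with he | he
        · exact Or.inr (Or.inr (hW _ _ _ e he))
        · exact Or.inl (hB e he)) hc hw
    refine hG.read_eq_of_precedes h1 (by rw [hPG]; exact hy) h2 ?_ hk₁.symm fun j c hj => ?_
    · refine precedes_append (hWt _ _ _) ⟨.inv k (.read x), ?_, rfl⟩
        (hW' _ _ hk₁.symm _ _) ?_ (hWc _ _ _)
      · rw [List.mem_append, List.mem_append] at *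
        tauto
      · intro e he
        rcases List.mem_append.1 he with he | he
        · exact hA' _ hk₁ e he
        rcases List.mem_append.1 he with he | he
        · exact hW' _ _ hk.symm _ _ e he
        · exact hB' _ hk₁ e he
    · rcases h4 j y c hj with ⟨h, -, h'⟩ | ⟨-, h, -⟩
      · exact ⟨h, h'⟩
      · exact absurd h.symm hxy
  have hPF : (A ++ (writer k₂ x c₂ ++ (writer k₁ y c₁ ++ B))).proj k = A ++ B := by
    rw [proj_append, proj_append, proj_append, pA, pB, pW' _ _ hk₁.symm, pW' _ _ hk₂.symm]
    rfl
  obtain ⟨h1, -, h3, h4⟩ := facts_of_proj (k₁ := k₁) (k₂ := k₂) (x := x) (y := y) (c₁ := c₁)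
    (c₂ := c₂) hPF
    (by rw [proj_append, proj_append, proj_append, pA' _ hk₁, pB' _ hk₁, pW, pW' _ _ hk.symm]; rfl)
    (by rw [proj_append, proj_append, proj_append, pA' _ hk₂, pB' _ hk₂, pW, pW' _ _ hk]; rfl)
    (fun e he => by
      rcases List.mem_append.1 he with he | he
      · exact Or.inl (hA e he)
      rcases List.mem_append.1 he with he | he
      · exact Or.inr (Or.inr (hW _ _ _ e he))
      rcases List.mem_append.1 he with he | he
      · exact Or.inr (Or.inl (hW _ _ _ e he))
      · exact Or.inl (hB e he)) hc hw
  -- In the first history, having read `c₁ ≠ init y` places the writer of `y` before the reader in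
  -- the serialization, and real-time order places the writer of `x` earlier still.
  refine hF.read_eq_of_reads_later (m := k₁) h1 (by rw [hPF]; exact hx) (by rw [hPF]; exact hy)
    (hb ▸ hc₁) h3 ?_ hk₂.symm hk₁.symm hk.symm (fun j c hj => ?_) fun j c hj => ?_
  · rw [← List.append_assoc]
    refine precedes_append ?_ ?_ ?_ ?_ ?_
    · exact ⟨.inv k₂ .tryC, by simp, rfl⟩
    · exact ⟨.inv k₁ .tryC, by simp, rfl⟩
    · intro e he
      rcases List.mem_append.1 he with he | he
      · exact hA' _ hk₁ e he
      · exact hW' _ _ hk.symm _ _ e he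
    · intro e he
      rcases List.mem_append.1 he with he | he
      · exact hW' _ _ hk _ _ e he
      · exact hB' _ hk₂ e he
    · rw [Committed, proj_append, pA' _ hk₂, pW]
      simp
  · rcases h4 j x c hj with ⟨-, h, -⟩ | ⟨h, -, h'⟩
    · exact absurd h hxy
    · exact ⟨h, h'⟩
  · rcases h4 j y c hj with ⟨h, -, -⟩ | ⟨-, h, -⟩
    · exact h
    · exact absurd h.symm hxy

end History

/-! ### The contradiction, and the count along the reader execution -/

namespace TM

variable {n : ℕ} {X : Type u} {V : Type v} {M : TM.{u, v, w} n X V}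

lemma exists_two_others (hn : 3 ≤ n) (p : Fin n) : ∃ q₁ q₂ : Fin n, p ≠ q₁ ∧ p ≠ q₂ ∧ q₁ ≠ q₂ := by
  have hcard : 1 < (Finset.univ.erase p).card := by
    rw [Finset.card_erase_of_mem (Finset.mem_univ p), Finset.card_univ, Fintype.card_fin]
    omega
  obtain ⟨a, ha, b, hb, hab⟩ := Finset.one_lt_card.1 hcard
  exact ⟨a, b, (Finset.ne_of_mem_erase ha).symm, (Finset.ne_of_mem_erase hb).symm, hab⟩

/-- A t-read of a transaction running alone from the initial configuration contains a RAW or an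
AWAR, if the transaction has not accessed the t-object before, and there is another t-object that it
has not accessed. -/
lemma performsRAW_or_performsAWAR [Nontrivial V] (hn : 3 ≤ n) (hRWF : M.RWF) (hDAP : M.WeakDAP)
    {p : Fin n} {k : TxnId} {σ α : List M.Event} {x y : X} {a : V}
    (hex : M.IsExec (σ ++ α)) (hσ : Solo p k σ) (hα : IsOpFragment p k (.read x) (.val a) α)
    (hro : (history σ).ReadOnly k) (hx : x ∉ (history σ).dset k) (hy : y ∉ (history σ).dset k)
    (hxy : x ≠ y) : PerformsRAW α k ∨ PerformsAWAR α k := by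
  obtain ⟨hser, hwf, hsp⟩ := hRWF
  by_contra hcon
  obtain ⟨hraw, hawar⟩ := not_or.1 hcon
  obtain ⟨lam, mu, hsplit, hlam, hmu⟩ := hα.split hraw hawar
  have hαs : Solo p k (lam ++ mu) := hsplit ▸ hα.solo
  -- Reading `c₁` in `y` betrays that its writer was serialized before; `c₂` differs from the value
  -- `a` that the read of `x` has returned.
  obtain ⟨c₁, hc₁⟩ := exists_ne (M.initObj y)
  obtain ⟨c₂, hc₂⟩ := exists_ne a
  obtain ⟨q₁, q₂, hp₁, hp₂, hq⟩ := exists_two_others hn p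
  obtain ⟨k₁, k₂, hk₁, hk₂, hk⟩ : ∃ k₁ k₂, k ≠ k₁ ∧ k ≠ k₂ ∧ k₁ ≠ k₂ :=
    ⟨k + 1, k + 2, by simp, by simp, by simp⟩
  obtain ⟨ρ, hρ, hρs, hρh⟩ := hsp.exists_writer q₁ k₁ y c₁
  obtain ⟨β, hβ, hβs, hβh⟩ := hsp.exists_writer q₂ k₂ x c₂
  have hρd : (history ρ).dset k₁ = {y} := by
    ext z; simp [hρh, History.dset, History.rset, History.wset]
  have hβd : (history β).dset k₂ = {x} := by
    ext z; simp [hβh, History.dset, History.rset, History.wset]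
  have hαd : (history (σ ++ α)).dset k ⊆ insert x ((history σ).dset k) := by
    intro z hz
    simp only [History.dset, History.rset, History.wset, history_append, hα.history_eq,
      List.mem_append, List.mem_cons, HEvent.inv.injEq, Op.read.injEq, reduceCtorEq,
      List.not_mem_nil, and_false, or_false, true_and, Set.mem_union, Set.mem_ofPred_eq,
      Set.mem_insert_iff] at hz ⊢
    tauto
  have hσlam : σ ++ lam <+: σ ++ α := by
    rw [hsplit, ← List.append_assoc]
    exact List.prefix_append _ _
  rw [hsplit, isExec_iff, ← List.append_assoc, Config.valid_append] at hex
  obtain ⟨hvσlam, hvmu⟩ := hex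
  obtain ⟨hvσ, hvlam⟩ := (Config.valid_append _ _ _).1 hvσlam
  rw [isExec_iff] at hρ hβ
  have i₁ : ∀ e ∈ σ ++ lam, ∀ e' ∈ ρ, Event.Indep e e' := by
    refine indep_of_disjoint hDAP hp₁ hk₁ (isExec_iff.2 hvσlam) (isExec_iff.2 hρ)
      (hσ.append hαs.left) hρs ?_
    rw [hρd, Set.disjoint_singleton_right]
    intro h
    rcases hαd (dset_mono hσlam k h) with h | h
    · exact hxy h.symm
    · exact hy h
  -- Only `σ` is claimed independent of `β`: `lam` already belongs to the read of `x`, so weak DAP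
  -- permits it to contend with the writer of `x`.
  have i₂ : ∀ e ∈ σ, ∀ e' ∈ β, Event.Indep e e' := by
    refine indep_of_disjoint hDAP hp₂ hk₂ (isExec_iff.2 hvσ) (isExec_iff.2 hβ) hσ hβs ?_
    rwa [hβd, Set.disjoint_singleton_right]
  have i₃ : ∀ e ∈ ρ, ∀ e' ∈ β, Event.Indep e e' := by
    refine indep_of_disjoint hDAP hq hk (isExec_iff.2 hρ) (isExec_iff.2 hβ) hρs hβs ?_
    rw [hρd, hβd, Set.disjoint_singleton]
    exact hxy.symm
  -- After `σ`, `β` runs by independence; inserting `lam` in between changes no base object, so the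
  -- process of `β` does not notice.
  have hvβ : (M.initConfig.run (σ ++ lam)).Valid β := by
    rw [Config.run_append]
    refine (Config.Valid.commute i₂ hvσ hβ).1.congr hβs (Config.run_mem_of_not_nontrivial _ hlam)
      (Config.run_of_ne _ (hαs.left.proc_ne hp₂)).1
      (Config.run_of_ne _ (hαs.left.proc_ne hp₂)).2
      (Config.mem_used_run_of_ne _ (hαs.left.txn_ne hk₂))
  have hvA : M.initConfig.Valid (σ ++ lam ++ β) := (Config.valid_append _ _ _).2 ⟨hvσlam, hvβ⟩
  have i₄ : ∀ e ∈ σ ++ lam ++ β, ∀ e' ∈ ρ, Event.Indep e e' := by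
    intro e he e' he'
    rcases List.mem_append.1 he with he | he
    · exact i₁ e he e' he'
    · exact (i₃ e' he' e he).symm
  obtain ⟨hvρ, hvA', hrun⟩ := Config.Valid.commute i₄ hvA hρ
  -- By `hrun`, this configuration is also reached when `ρ` runs first.
  set d := (M.initConfig.run (σ ++ lam ++ β)).run ρ with hd
  have hdp : d.st p = (M.initConfig.run (σ ++ lam)).st p ∧
      d.status p = (M.initConfig.run (σ ++ lam)).status p := by
    have h1 := Config.run_of_ne (M.initConfig.run (σ ++ lam)) (hβs.proc_ne hp₂.symm)
    have h2 := Config.run_of_ne (M.initConfig.run (σ ++ lam ++ β)) (hρs.proc_ne hp₁.symm)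
    rw [Config.run_append _ (σ ++ lam)] at h2
    rw [hd, Config.run_append _ (σ ++ lam), h2.1, h2.2]
    exact h1
  -- The empty `W` means that nothing is required of the memory of `d`: the reader finishes its read
  -- of `x` as if neither writer had run, still returning `a`.
  obtain ⟨hdv, hds⟩ := hmu.transfer hαs.right hvmu hdp.1 hdp.2 (by simp)
  have hact : (d.run mu).status p = .active k := by
    rw [hds, ← Config.run_append, List.append_assoc, ← hsplit, Config.run_append]
    exact hα.status id _
  have hαh : history lam ++ history mu = [.inv k (.read x), .ret k (.val a)] := by
    rw [← history_append, ← hsplit, hα.history_eq]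
  have hF₀ : M.IsExec (σ ++ lam ++ β ++ ρ ++ mu) := by
    rw [isExec_iff, Config.valid_append _ _ mu, Config.valid_append _ _ ρ, Config.run_append _ _ ρ]
    exact ⟨⟨hvA, hvρ⟩, hdv⟩
  have hlamro : (history lam).ReadOnly k ∧ (history mu).ReadOnly k := by
    have := hα.readOnly (by simp) k
    simp only [hsplit, History.ReadOnly, History.wset, history_append, List.mem_append,
      Set.eq_empty_iff_forall_notMem, Set.mem_ofPred_eq, not_exists, not_or] at this ⊢
    exact ⟨fun z b => (this z b).1, fun z b => (this z b).2⟩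
  have hF₀ro : (history (σ ++ lam ++ β ++ ρ ++ mu)).ReadOnly k := by
    refine readOnly_append (readOnly_append (readOnly_append (readOnly_append hro hlamro.1) ?_) ?_)
      hlamro.2
    · simp [History.ReadOnly, History.wset, hβh, hk₂]
    · simp [History.ReadOnly, History.wset, hρh, hk₁]
  have hready : Ready (M.initConfig.run (σ ++ lam ++ β ++ ρ ++ mu)) p k := by
    rw [Config.run_append _ _ mu, Config.run_append _ _ ρ]
    exact Or.inr hact
  obtain ⟨b, τ, hτ, hF₁⟩ := hwf.exists_read hF₀ hready hF₀ro y
  obtain ⟨γ, hγ, hF⟩ := hwf.exists_commit hF₁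
    (by rw [Config.run_append _ _ τ]; exact Or.inr (hτ.status id _))
    (readOnly_append hF₀ro (hτ.readOnly (by simp) k))
  -- The same continuation is valid because it starts from the same configuration `d`; no progress
  -- argument is repeated, and the value `b` is the same in both executions.
  have hG : M.IsExec (ρ ++ (σ ++ lam ++ β) ++ mu ++ τ ++ γ) := by
    rw [isExec_iff] at hF ⊢
    rw [List.append_assoc, List.append_assoc, Config.valid_append _ _ (mu ++ (τ ++ γ))] at hF ⊢
    rw [Config.run_append _ _ ρ, ← hd] at hF
    rw [Config.run_append, ← hrun]
    exact ⟨(Config.valid_append _ _ _).2 ⟨hρ, hvA'⟩, hF.2⟩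
  have hP : history (σ ++ lam) ++ history (mu ++ (τ ++ γ)) =
      history σ ++ ([.inv k (.read x), .ret k (.val a)] ++
        ([.inv k (.read y), .ret k (.val b)] ++ [.inv k .tryC, .ret k .commit])) := by
    rw [← hαh, ← hτ.history_eq, ← hγ.history_eq]
    simp
  refine hc₂ (History.read_eq_of_two_orders (init := M.initObj) (A := history (σ ++ lam))
    (B := history (mu ++ (τ ++ γ))) (b := b) hk₁ hk₂ hk hxy ?_ ?_ ?_ ?_ ?_ ?_ hc₁ ?_ ?_).symm
  · exact fun e he => txn_of_mem_history (P := fun l => l = k)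
      (fun e he => (hσ.append hαs.left e he).2) he
  · exact fun e he => txn_of_mem_history (P := fun l => l = k)
      (fun e he => (hαs.right.append (hτ.solo.append hγ.solo) e he).2) he
  · rw [hP]; simp
  · rw [hP]
    intro z c hz
    have hw : HEvent.inv k (.write z c) ∉ history σ := fun h =>
      Set.eq_empty_iff_forall_notMem.1 hro z ⟨c, h⟩
    simp [hw] at hz
  · rw [hP]
    exact ⟨history σ, _, List.append_assoc _ _ _⟩
  · rw [hP]
    exact ⟨history σ ++ [.inv k (.read x), .ret k (.val a)], [.inv k .tryC, .ret k .commit],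
      by simp⟩
  · have := hser _ hF
    simp only [List.append_assoc, history_append, hρh, hβh] at this ⊢
    exact this
  · have := hser _ hG
    simp only [List.append_assoc, history_append, hρh, hβh] at this ⊢
    exact this

lemma mem_history_flatten {L : List (List M.Event)} {h : HEvent X V} :
    h ∈ history L.flatten ↔ ∃ A ∈ L, h ∈ history A := by
  simp only [history, List.mem_filterMap, List.mem_flatten]
  constructor
  · rintro ⟨e, ⟨A, hA, he⟩, h⟩
    exact ⟨A, hA, e, he, h⟩
  · rintro ⟨A, hA, e, he, h⟩
    exact ⟨e, ⟨A, hA, he⟩, h⟩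

section Reader

variable {p : Fin n} {k : TxnId} {m : ℕ} {x : Fin m → X} {α : Fin m → List M.Event}
  {E : List M.Event}

lemma IsReaderExec.mem_history_inv (h : M.IsReaderExec p k x α E) {o : Op X V} :
    .inv k o ∈ history E ↔ (∃ i, o = .read (x i)) ∨ o = .tryC := by
  obtain ⟨-, hα, γ, hγ, rfl⟩ := h
  have key : ∀ i, HEvent.inv k o ∈ history (α i) ↔ o = .read (x i) := by
    intro i
    obtain ⟨a, ha⟩ := hα i
    simp [ha.history_eq]
  simp [mem_history_flatten, List.mem_ofFn, key, hγ.history_eq]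

lemma IsReaderExec.readOnly (h : M.IsReaderExec p k x α E) : (history E).ReadOnly k := by
  refine Set.eq_empty_iff_forall_notMem.2 ?_
  rintro z ⟨a, hz⟩
  simpa using h.mem_history_inv.1 hz

lemma IsReaderExec.rset_eq (h : M.IsReaderExec p k x α E) :
    (history E).rset k = Set.range x := by
  ext z
  simp [History.rset, h.mem_history_inv, eq_comm]

/-- The next object in the sequence serves as the unread `y`, and injectivity of `x` keeps it and
the current object out of the data set of the prefix. The last read has no such successor. -/
lemma IsReaderExec.performs [Nontrivial V] (hn : 3 ≤ n) (hRWF : M.RWF) (hDAP : M.WeakDAP)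
    (hx : Function.Injective x) (h : M.IsReaderExec p k x α E) (i : Fin m)
    (hi : (i : ℕ) + 1 < m) : PerformsRAW (α i) k ∨ PerformsAWAR (α i) k := by
  obtain ⟨hex, hα, γ, hγ, rfl⟩ := h
  have hL : List.ofFn α = (List.ofFn α).take i ++ α i :: (List.ofFn α).drop (i + 1) := by
    conv_lhs => rw [← List.take_append_drop i (List.ofFn α)]
    rw [List.drop_eq_getElem_cons (by simp)]
    simp
  have hmem : ∀ A ∈ (List.ofFn α).take i, ∃ j, j < i ∧ A = α j := by
    intro A hA
    obtain ⟨j, hj, rfl⟩ := List.mem_take_iff_getElem.1 hA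
    rw [List.length_ofFn] at hj
    exact ⟨⟨j, by omega⟩, Fin.lt_def.2 (by simp; omega), by simp⟩
  set σ := ((List.ofFn α).take i).flatten with hσ
  have hinv : ∀ o, .inv k o ∈ history σ → ∃ j, j < i ∧ o = .read (x j) := by
    intro o ho
    obtain ⟨A, hA, hoA⟩ := mem_history_flatten.1 ho
    obtain ⟨j, hj, rfl⟩ := hmem A hA
    obtain ⟨a, ha⟩ := hα j
    exact ⟨j, hj, by simpa [ha.history_eq] using hoA⟩
  have hro : (history σ).ReadOnly k := by
    refine Set.eq_empty_iff_forall_notMem.2 ?_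
    rintro z ⟨a, hz⟩
    simpa using hinv _ hz
  have hd : ∀ j, i ≤ j → x j ∉ (history σ).dset k := by
    rintro j hj (h | ⟨a, h⟩)
    · obtain ⟨l, hl, h⟩ := hinv _ h
      rw [Op.read.injEq] at h
      exact absurd (hx h ▸ hl) (not_lt.2 hj)
    · simpa using hinv _ h
  obtain ⟨a, ha⟩ := hα i
  refine performsRAW_or_performsAWAR hn hRWF hDAP (σ := σ) (x := x i) (y := x ⟨i + 1, hi⟩) (p := p)
    ?_ ?_ ha hro (hd i le_rfl) (hd _ (Fin.le_def.2 (by simp))) ?_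
  · rw [hL, List.flatten_append, List.flatten_cons, ← List.append_assoc, List.append_assoc,
      isExec_iff, Config.valid_append] at hex
    exact isExec_iff.2 hex.1
  · intro e he
    obtain ⟨A, hA, he⟩ := List.mem_flatten.1 he
    obtain ⟨j, -, rfl⟩ := hmem A hA
    obtain ⟨b, hb⟩ := hα j
    exact hb.solo e he
  · intro h
    have := congrArg Fin.val (hx h)
    simp at this

end Reader

/-- The counted fragments are all reads but the last, which are contiguous from the start; for `m =
0` the truncated `m - 1` leaves an empty family. -/
lemma flatten_init_infix {m : ℕ} (α : Fin m → List M.Event) (γ : List M.Event) :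
    (List.ofFn fun i : Fin (m - 1) => α ⟨i, by omega⟩).flatten <:+:
      (List.ofFn α).flatten ++ γ := by
  cases m with
  | zero => exact ⟨[], γ, by simp⟩
  | succ m =>
    refine ⟨[], α (Fin.last m) ++ γ, ?_⟩
    rw [List.ofFn_succ' α]
    simp [Fin.castSucc, Fin.castAdd, Fin.castLE]

end TM

end TMem

end

theorem theorem2 {n : ℕ} (hn : 3 ≤ n) {X : Type*} {V : Type*} [Nontrivial V]
    (M : TMem.TM n X V) (hRWF : M.RWF) (hDAP : M.WeakDAP)
    (m : ℕ) (x : Fin m → X) (hx : Function.Injective x) (p : Fin n) (k : TMem.TxnId) :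
    (∃ α E, M.IsReaderExec p k x α E) ∧
    ∀ α E, M.IsReaderExec p k x α E →
      (TMem.TM.history E).ReadOnly k ∧
      ((TMem.TM.history E).rset k).ncard = m ∧
      (∀ i : Fin m, (i : ℕ) + 1 < m →
        TMem.TM.PerformsRAW (α i) k ∨ TMem.TM.PerformsAWAR (α i) k) ∧
      TMem.TM.PerformsAtLeast E k (m - 1) := by
  refine ⟨?_, fun α E h => ?_⟩
  · obtain ⟨α, h1, h2, h3, h4⟩ := hRWF.2.1.exists_reads p k x
    obtain ⟨γ, h5, h6⟩ := hRWF.2.1.exists_commit h2 h3 h4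
    exact ⟨α, _, h6, h1, γ, h5, rfl⟩
  · have hperf := h.performs hn hRWF hDAP hx
    refine ⟨h.readOnly, ?_, hperf, fun i => α ⟨i, by omega⟩, ?_, fun i => ?_⟩
    · rw [h.rset_eq, ← Set.image_univ, Set.ncard_image_of_injective _ hx, Set.ncard_univ,
        Nat.card_eq_fintype_card, Fintype.card_fin]
    · obtain ⟨-, -, γ, -, rfl⟩ := h
      exact TMem.TM.flatten_init_infix α γ
    · exact hperf ⟨i, by omega⟩ (by simp; omega)
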